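/- Consider Minkowski space with signature $(+,-,-,-)$, Cartesian coordinates $(t,x,y,z)$, metric $dt^2-dx^2-dy^2-dz^2$ and coframe $\vartheta^a=\delta^a_\mu dx^\mu$, together with a metric-compatible connection $\Gamma_a{}^b$ whose contorsion $K_{ab}=-K_{ba}$ is defined by $T^a=K_b{}^a\wedge\vartheta^b$, where $T^a=d\vartheta^a+\Gamma_c{}^a\wedge\vartheta^c$; let $R_a{}^b=d\Gamma_a{}^b+\Gamma_c{}^b\wedge\Gamma_a{}^c$. Let $b$ be a polarized Maxwell plane wave $$b=C\,e^{\pm i k(t+z)}\,(dx-i\alpha\,dy),\qquad C\in\mathbb R,\ k>0,\ \alpha\in\{-1,1\}.$$ The equations of motion of a Lagrangian $\mathbf L$ are $\delta S/\delta\vartheta^a=0$ and $\delta S/\delta\Gamma_a{}^b=0$, i.e. stationarity of $S=\int\mathbf L$ under all compactly supported smooth variations of the coframe and of the (unconstrained) connection, for $g_{ab}=\mathrm{diag}(1,-1,-1,-1)$. (1) Suppose $K_{ab}=\mathrm{Re}(b\,L_{ab})$, where $L_{ab}=-L_{ba}$ are complex constants with $\star(L_{ab}\vartheta^{a}\wedge\vartheta^{b})=\tilde\alpha\,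 i\,L_{ab}\vartheta^{a}\wedge\vartheta^{b}$, $\tilde\alpha\in\{-1,1\}$. Then the equations of motion of $\mathbf L^{\rm KV}=-\frac1{2\rho}R_a{}^b\wedge\star R_b{}^a$ are satisfied for every $\rho\ne0$. (2) Suppose $K_{\mu\nu\rho}=2\,\mathrm{Re}(b_\mu\partial_{[\nu}b_{\rho]})$ (first index: form index). Then this contorsion is again of the form considered in (1), with $k$ replaced by $2k$; the geometry is a Weyl pseudo-instanton, i.e. its nonmetricity vanishes and all the irreducible parts ${}^{(I)}W_{ab}$, ${}^{(I)}Z_{ab}$ of $R_{ab}$ other than the Weyl part ${}^{(1)}W_{ab}$ vanish; it is so also in the restrictive sense that the irreducible part is moreover required to be simple, i.e. not isomorphic, as a representation of the pseudo-orthogonal group, to any other of the eleven irreducible parts of the curvature; and for all real $w_1,\dots,w_6,z_1,\dots,z_5,v_1,\dots,v_5$ and all $\rho\neq0$ the equations of motion of the general strong-sector Lagrangian $$\mathbf L_{\rm s}=-\tfrac1{2\rho}R_{ab}\wedge\star\Big[\sum_{I=1}^6 w_I\,{}^{(I)}W^{ab}+v_1\vartheta^a\wedge(e_c\lrcorner{}^{(5)}W^{cb})+\sum_{I=1}^5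 z_I\,{}^{(I)}Z^{ab}+v_2\vartheta_c\wedge(e^a\lrcorner{}^{(2)}Z^{cb})+\sum_{I=3}^5 v_I\,\vartheta^a\wedge(e_c\lrcorner{}^{(I)}Z^{cb})\Big]$$ are satisfied. Here ${}^{(I)}W_{ab}$ and ${}^{(I)}Z_{ab}$ are the standard irreducible parts under the pseudo-orthogonal group of $R_{[ab]}$ and $R_{(ab)}$: ${}^{(1)}W$ Weyl, ${}^{(2)}W$ paircom, ${}^{(3)}W$ pseudoscalar, ${}^{(4)}W$ traceless symmetric Ricci, ${}^{(5)}W$ antisymmetric Ricci, ${}^{(6)}W$ Ricci scalar; ${}^{(1)}Z,\dots,{}^{(5)}Z$ of dimensions $30,9,6,9,6$, with ${}^{(3)}Z$ and ${}^{(4)}Z$ built from the antisymmetric and the symmetric part of $e^b\lrcorner({}Z_{ab}-{}^{(5)}Z_{ab})$, ${}^{(5)}Z_{ab}=\frac14g_{ab}Z_c{}^c$, and ${}^{(2)}Z$ from its dual. -/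

import Mathlib

open scoped ContDiff

noncomputable section

namespace MAG

/-! Metric-affine geometry on `ℝ⁴` with an orthonormal coframe.

Coordinates are `x 0, x 1, x 2, x 3 = t, x, y, z`.  Anholonomic indices `a, b, …` are raised and
lowered with `g_ab = g^ab = diag(1, -1, -1, -1)`. -/

/-- Points of `ℝ⁴`. -/
abbrev Pt := Fin 4 → ℝ

/-- The diagonal entries of `g_ab` (and of `g^ab`). -/
def eta : Fin 4 → ℝ := ![1, -1, -1, -1]

/-- The components `g_ab`. -/
def metric (a b : Fin 4) : ℝ := if a = b then eta a else 0

/-- The Levi-Civita symbol, `eps 0 1 2 3 = 1`. -/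
def eps (a b c d : Fin 4) : ℝ :=
  ((Matrix.det (Matrix.of fun i j : Fin 4 => if ![a, b, c, d] i = j then (1 : ℤ) else 0) : ℤ) : ℝ)

/-! ### Pointwise exterior algebra

A `p`-form at a point is given by its components in the coframe,
`α = (1/p!) α_{a₁…a_p} ϑ^{a₁} ∧ … ∧ ϑ^{a_p}`. -/

/-- Components of a 1-form. -/
abbrev Form1 := Fin 4 → ℝ

/-- Components of a 2-form (antisymmetry is not built in, see `IsTwoForm`). -/
abbrev Form2 := Fin 4 → Fin 4 → ℝ

/-- Components of a 3-form. -/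
abbrev Form3 := Fin 4 → Fin 4 → Fin 4 → ℝ

/-- The 1-form `ϑ^a`. -/
def thetaUp (a : Fin 4) : Form1 := fun c => if c = a then 1 else 0

/-- The 1-form `ϑ_a = g_ab ϑ^b`. -/
def theta (a : Fin 4) : Form1 := fun c => metric a c

/-- `α ∧ β` for 1-forms. -/
def wedge11 (α β : Form1) : Form2 := fun c d => α c * β d - α d * β c

/-- `α ∧ β` for a 2-form `α` and a 1-form `β`. -/
def wedge21 (α : Form2) (β : Form1) : Form3 :=
  fun c d e => α c d * β e + α d e * β c + α e c * β d

/-- The coefficient of `ϑ⁰ ∧ ϑ¹ ∧ ϑ² ∧ ϑ³` in `α ∧ β` for 2-forms. -/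
def wedge22 (α β : Form2) : ℝ :=
  (1 / 4) * ∑ a, ∑ b, ∑ c, ∑ d, eps a b c d * α a b * β c d

/-- The interior product `e_a ⌟ α` of a 2-form. -/
def int2 (a : Fin 4) (α : Form2) : Form1 := fun d => α a d

/-- The Hodge dual of a 2-form with real or complex components:
`(⋆α)_{cd} = (1/2!) α^{ab} ε_{abcd}`. -/
def star2 {V : Type*} [AddCommGroup V] [Module ℝ V] (α : Fin 4 → Fin 4 → V) :
    Fin 4 → Fin 4 → V :=
  fun c d => (1 / 2 : ℝ) • ∑ a, ∑ b, (eta a * eta b * eps a b c d) • α a b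

/-- The Hodge dual of a 3-form: `(⋆α)_d = (1/3!) α^{abc} ε_{abcd}`. -/
def star3 (α : Form3) : Form1 :=
  fun d => (1 / 6) * ∑ a, ∑ b, ∑ c, eta a * eta b * eta c * eps a b c d * α a b c

/-! ### Irreducible parts of the curvature -/

/-- Components of a matrix of 2-forms with both external indices lowered: `R a b : Form2` is
`R_ab`, and `R a b c d` is the component along `½ ϑ^c ∧ ϑ^d`. -/
abbrev Curv := Fin 4 → Fin 4 → Form2

/-- The entries of `R` are 2-forms. -/
def IsTwoForm (R : Curv) : Prop := ∀ a b c d, R a b c d = - R a b d c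

/-- `W_ab = R_[ab]`. -/
def Wof (R : Curv) : Curv := fun a b => (1 / 2 : ℝ) • (R a b - R b a)

/-- `Z_ab = R_(ab)`. -/
def Zof (R : Curv) : Curv := fun a b => (1 / 2 : ℝ) • (R a b + R b a)

/-- `e^b ⌟ S_ab`, a covector-valued 1-form (first index external). -/
def contr (S : Curv) (a : Fin 4) : Form1 := ∑ b, eta b • int2 b (S a b)

/-- `⋆(S_ba ∧ ϑ^b)`, a covector-valued 1-form (first index external). -/
def contrBar (S : Curv) (a : Fin 4) : Form1 := star3 (∑ b, wedge21 (S b a) (thetaUp b))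

/-- `e_a ⌟ ξ^a` for a covector-valued 1-form `ξ_a`. -/
def trace1 (ξ : Fin 4 → Form1) : ℝ := ∑ a, eta a * ξ a a

/-- `ϑ^b ∧ ξ_b` for a covector-valued 1-form `ξ_a`. -/
def antis (ξ : Fin 4 → Form1) : Form2 := ∑ b, wedge11 (thetaUp b) (ξ b)

/-- `ϑ_[a ∧ ξ_b]`. -/
def thetaAlt (ξ : Fin 4 → Form1) : Curv :=
  fun a b => (1 / 2 : ℝ) • (wedge11 (theta a) (ξ b) - wedge11 (theta b) (ξ a))

/-- `ϑ_(a ∧ ξ_b)`. -/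
def thetaSym (ξ : Fin 4 → Form1) : Curv :=
  fun a b => (1 / 2 : ℝ) • (wedge11 (theta a) (ξ b) + wedge11 (theta b) (ξ a))

/-- `X_a = e^b ⌟ W_ab`. -/
def X (R : Curv) (a : Fin 4) : Form1 := contr (Wof R) a

/-- `X̄_a = ⋆(W_ba ∧ ϑ^b)`. -/
def Xbar (R : Curv) (a : Fin 4) : Form1 := contrBar (Wof R) a

/-- `Ψ_a = X_a - ¼ X ϑ_a - ½ e_a ⌟ (ϑ^b ∧ X_b)`. -/
def Psi (R : Curv) (a : Fin 4) : Form1 :=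
  X R a - ((1 / 4) * trace1 (X R)) • theta a - (1 / 2 : ℝ) • int2 a (antis (X R))

/-- `Ψ̄_a = X̄_a - ¼ X̄ ϑ_a - ½ e_a ⌟ (ϑ^b ∧ X̄_b)`. -/
def Psibar (R : Curv) (a : Fin 4) : Form1 :=
  Xbar R a - ((1 / 4) * trace1 (Xbar R)) • theta a - (1 / 2 : ℝ) • int2 a (antis (Xbar R))

/-- The paircom part. -/
def W2 (R : Curv) : Curv := fun a b => - star2 (thetaAlt (Psibar R) a b)

/-- The pseudoscalar part. -/
def W3 (R : Curv) : Curv :=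
  fun a b => (-(1 / 12) * trace1 (Xbar R)) • star2 (wedge11 (theta a) (theta b))

/-- The traceless symmetric Ricci part. -/
def W4 (R : Curv) : Curv := - thetaAlt (Psi R)

/-- The antisymmetric Ricci part. -/
def W5 (R : Curv) : Curv := (-(1 / 2) : ℝ) • thetaAlt (fun b => int2 b (antis (X R)))

/-- The Ricci scalar part. -/
def W6 (R : Curv) : Curv :=
  fun a b => (-(1 / 12) * trace1 (X R)) • wedge11 (theta a) (theta b)

/-- The Weyl part. -/
def W1 (R : Curv) : Curv := Wof R - (W2 R + W3 R + W4 R + W5 R + W6 R)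

/-- The trace part of `Z_ab`. -/
def Z5 (R : Curv) : Curv := fun a b => ((1 / 4) * metric a b) • ∑ c, eta c • Zof R c c

/-- `Y_a = e^b ⌟ (Z_ab - Z5_ab)`. -/
def Y (R : Curv) (a : Fin 4) : Form1 := contr (Zof R - Z5 R) a

/-- `Ȳ_a = ⋆((Z_ba - Z5_ba) ∧ ϑ^b)`. -/
def Ybar (R : Curv) (a : Fin 4) : Form1 := contrBar (Zof R - Z5 R) a

/-- `Φ_a = Y_a - ½ e_a ⌟ (ϑ^b ∧ Y_b)`. -/
def Phi (R : Curv) (a : Fin 4) : Form1 := Y R a - (1 / 2 : ℝ) • int2 a (antis (Y R))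

/-- `Φ̄_a = Ȳ_a - ½ e_a ⌟ (ϑ^b ∧ Ȳ_b)`. -/
def Phibar (R : Curv) (a : Fin 4) : Form1 := Ybar R a - (1 / 2 : ℝ) • int2 a (antis (Ybar R))

/-- Second part of `Z_ab`. -/
def Z2 (R : Curv) : Curv := fun a b => (-(1 / 2) : ℝ) • star2 (thetaSym (Phibar R) a b)

/-- Third part of `Z_ab`. -/
def Z3 (R : Curv) : Curv := fun a b =>
  (1 / 12 : ℝ) • ((4 : ℝ) • thetaSym (fun b => int2 b (antis (Y R))) a b
    - (2 * metric a b) • antis (Y R))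

/-- Fourth part of `Z_ab`. -/
def Z4 (R : Curv) : Curv := (1 / 2 : ℝ) • thetaSym (Phi R)

/-- First part of `Z_ab`. -/
def Z1 (R : Curv) : Curv := Zof R - (Z2 R + Z3 R + Z4 R + Z5 R)

/-- The six irreducible parts of `W_ab`, numbered from `0`. -/
def Wpart (I : Fin 6) : Curv → Curv := ![W1, W2, W3, W4, W5, W6] I

/-- The five irreducible parts of `Z_ab`, numbered from `0`. -/
def Zpart (I : Fin 5) : Curv → Curv := ![Z1, Z2, Z3, Z4, Z5] I

/-- Labels of the eleven irreducible parts of the curvature. -/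
abbrev PartIdx := Fin 6 ⊕ Fin 5

/-- All eleven irreducible parts of the curvature. -/
def part : PartIdx → Curv → Curv
  | .inl I => Wpart I
  | .inr I => Zpart I

/-- The label of the Weyl part. -/
def weyl : PartIdx := .inl 0

/-- The space of curvature tensors that consist of a single irreducible part. -/
def partSpace (I : PartIdx) : Submodule ℝ Curv :=
  Submodule.span ℝ {S | ∃ R, IsTwoForm R ∧ S = part I R}

/-- Membership in the pseudo-orthogonal group `O(1,3)`. -/
def IsLorentz (Λ : Matrix (Fin 4) (Fin 4) ℝ) : Prop :=
  Λ * Matrix.diagonal eta * Λ.transpose = Matrix.diagonal eta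

/-- The action of a change of orthonormal frame on curvature tensors. -/
def act (Λ : Matrix (Fin 4) (Fin 4) ℝ) (R : Curv) : Curv := fun a b c d =>
  ∑ a', ∑ b', ∑ c', ∑ d', Λ a a' * Λ b b' * Λ c c' * Λ d d' * R a' b' c' d'

/-- Two irreducible parts are isomorphic as representations of the pseudo-orthogonal group. -/
def PartsIsomorphic (I J : PartIdx) : Prop :=
  ∃ f : partSpace I ≃ₗ[ℝ] partSpace J, ∀ Λ, IsLorentz Λ → ∀ x y : partSpace I,
    (y : Curv) = act Λ (x : Curv) → (f y : Curv) = act Λ (f x : Curv)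

/-- An irreducible part is simple if it is not isomorphic to any other irreducible part. -/
def IsSimplePart (I : PartIdx) : Prop := ∀ J, J ≠ I → ¬ PartsIsomorphic I J

/-! ### Fields: coframe, connection, nonmetricity, torsion, curvature -/

/-- The partial derivative `∂_μ f` at `x`. -/
def pd {V : Type*} [NormedAddCommGroup V] [NormedSpace ℝ V] (μ : Fin 4) (f : Pt → V) (x : Pt) : V :=
  fderiv ℝ f x (Pi.single μ 1)

/-- A coframe field: `θ x μ a` is `e_μ^a`, i.e. `ϑ^a = e_μ^a dx^μ`. -/
abbrev Coframe := Pt → Fin 4 → Fin 4 → ℝ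

/-- A connection: `Γ x μ a b` is `Γ_{μa}^b`, i.e. `Γ_a^b = Γ_{μa}^b dx^μ`. -/
abbrev Connection := Pt → Fin 4 → Fin 4 → Fin 4 → ℝ

/-- The Cartesian coframe `ϑ^a = δ^a_μ dx^μ` of Minkowski space. -/
def cartesian : Coframe := fun _ μ a => if μ = a then 1 else 0

/-- The nonmetricity `Q_{μab} = -(∂_μ g_ab - Γ_{μa}^c g_cb - Γ_{μb}^c g_ac)`, for constant
`g_ab`. -/
def nonmetricity (Γ : Connection) (x : Pt) (μ a b : Fin 4) : ℝ :=
  (∑ c, Γ x μ a c * metric c b) + ∑ c, Γ x μ b c * metric a c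

/-- Metric compatibility: the nonmetricity vanishes. -/
def MetricCompatible (Γ : Connection) : Prop := ∀ x μ a b, nonmetricity Γ x μ a b = 0

/-- The components `T_{μν}^a` of the torsion `T^a = dϑ^a + Γ_c^a ∧ ϑ^c`. -/
def torsion (θ : Coframe) (Γ : Connection) (x : Pt) (a μ ν : Fin 4) : ℝ :=
  pd μ (fun y => θ y ν a) x - pd ν (fun y => θ y μ a) x
    + ∑ c, (Γ x μ c a * θ x ν c - Γ x ν c a * θ x μ c)

/-- `K_ab`, with coordinate components `K x μ a b = K_{μab}`, is the contorsion of the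
geometry: it is antisymmetric in `ab` and `T^a = K_b^a ∧ ϑ^b`. -/
def HasContorsion (θ : Coframe) (Γ : Connection) (K : Pt → Fin 4 → Fin 4 → Fin 4 → ℝ) : Prop :=
  (∀ x μ a b, K x μ a b = - K x μ b a) ∧
  ∀ x a μ ν, torsion θ Γ x a μ ν =
    ∑ b, ((eta a * K x μ b a) * θ x ν b - (eta a * K x ν b a) * θ x μ b)

/-- The coordinate components `R_{μνa}^b` of the curvature
`R_a^b = dΓ_a^b + Γ_c^b ∧ Γ_a^c`. -/
def curvature (Γ : Connection) (x : Pt) (a b μ ν : Fin 4) : ℝ :=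
  pd μ (fun y => Γ y ν a b) x - pd ν (fun y => Γ y μ a b) x
    + ∑ c, (Γ x μ c b * Γ x ν a c - Γ x ν c b * Γ x μ a c)

/-- The components of `R_ab` in the coframe, with `b` lowered; `e^μ_c` is the inverse of
`e_μ^a`. -/
def frameCurvature (θ : Coframe) (Γ : Connection) (x : Pt) : Curv := fun a b c d =>
  ∑ μ, ∑ ν, (Matrix.of (θ x))⁻¹ c μ * (Matrix.of (θ x))⁻¹ d ν *
    ∑ f, curvature Γ x a f μ ν * metric f b

/-! ### Lagrangians and their equations of motion

A Lagrangian 4-form is represented by the coefficient of `ϑ⁰ ∧ ϑ¹ ∧ ϑ² ∧ ϑ³`, a function of the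
frame components of the curvature. -/

/-- The coefficient of `ϑ⁰ ∧ ϑ¹ ∧ ϑ² ∧ ϑ³` in `R_ab ∧ ⋆ S^ab`. -/
def pairing (R S : Curv) : ℝ := ∑ a, ∑ b, eta a * eta b * wedge22 (R a b) (star2 (S a b))

/-- The Yang–Mills-like Lagrangian `-(1/2ρ) R_a^b ∧ ⋆ R_b^a`. -/
def lagKV (ρ : ℝ) (R : Curv) : ℝ := -(1 / (2 * ρ)) * pairing R (fun a b => R b a)

/-- `ϑ_a ∧ (e_c ⌟ S^c_b)`. -/
def mixA (S : Curv) : Curv := fun a b => wedge11 (theta a) (∑ c, eta c • int2 c (S c b))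

/-- `ϑ_c ∧ (e_a ⌟ S^c_b)`. -/
def mixB (S : Curv) : Curv := fun a b => ∑ c, wedge11 (thetaUp c) (int2 a (S c b))

/-- The general even-parity Lagrangian quadratic in the curvature (strong sector), with
parameters `w₁,…,w₆`, `z₁,…,z₅`, `v₁,…,v₅` (numbered from `0`):
`-(1/2ρ) R_ab ∧ ⋆[∑ w_I W_I^ab + v₁ ϑ^a ∧ (e_c ⌟ W₅^cb) + ∑ z_I Z_I^ab
+ v₂ ϑ_c ∧ (e^a ⌟ Z₂^cb) + ∑_{I=3}^5 v_I ϑ^a ∧ (e_c ⌟ Z_I^cb)]`. -/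
def lagStrong (ρ : ℝ) (w : Fin 6 → ℝ) (z v : Fin 5 → ℝ) (R : Curv) : ℝ :=
  -(1 / (2 * ρ)) * pairing R
    ((∑ I, w I • Wpart I R) + v 0 • mixA (W5 R) + (∑ I, z I • Zpart I R) + v 1 • mixB (Z2 R)
      + (v 2 • mixA (Z3 R) + v 3 • mixA (Z4 R) + v 4 • mixA (Z5 R)))

/-- The Lagrangian density with respect to `dt dx dy dz`. -/
def density (ℓ : Curv → ℝ) (θ : Coframe) (Γ : Connection) (x : Pt) : ℝ :=
  (Matrix.of (θ x)).det * ℓ (frameCurvature θ Γ x)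

/-- The equation of motion `δS/δϑ^a = 0`: the action is stationary under all compactly supported
smooth variations of the coframe, at fixed connection. -/
def CoframeEquation (ℓ : Curv → ℝ) (θ : Coframe) (Γ : Connection) : Prop :=
  ∀ δ : Pt → Fin 4 → Fin 4 → ℝ, ContDiff ℝ ∞ δ → HasCompactSupport δ →
    HasDerivAt (fun ε : ℝ =>
      ∫ x, (density ℓ (fun y => θ y + ε • δ y) Γ x - density ℓ θ Γ x)) 0 0

/-- The equation of motion `δS/δΓ_a^b = 0`: the action is stationary under all compactly
supported smooth variations of the (unconstrained) connection, at fixed coframe. -/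
def ConnectionEquation (ℓ : Curv → ℝ) (θ : Coframe) (Γ : Connection) : Prop :=
  ∀ δ : Pt → Fin 4 → Fin 4 → Fin 4 → ℝ, ContDiff ℝ ∞ δ → HasCompactSupport δ →
    HasDerivAt (fun ε : ℝ =>
      ∫ x, (density ℓ θ (fun y => Γ y + ε • δ y) x - density ℓ θ Γ x)) 0 0

/-- The vacuum equations of motion of a curvature Lagrangian. -/
def EquationsOfMotion (ℓ : Curv → ℝ) (θ : Coframe) (Γ : Connection) : Prop :=
  CoframeEquation ℓ θ Γ ∧ ConnectionEquation ℓ θ Γ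

/-! ### Pseudo-instantons -/

/-- A pseudo-instanton of type `I`: the nonmetricity vanishes and the curvature consists of its
`I`-th irreducible part only. -/
def IsPseudoInstanton (θ : Coframe) (Γ : Connection) (I : PartIdx) : Prop :=
  MetricCompatible Γ ∧ ∀ x, frameCurvature θ Γ x = part I (frameCurvature θ Γ x) ∧
    ∀ J, J ≠ I → part J (frameCurvature θ Γ x) = 0

/-- A pseudo-instanton in the restrictive sense: in addition, the irreducible part is simple. -/
def IsSimplePseudoInstanton (θ : Coframe) (Γ : Connection) (I : PartIdx) : Prop :=
  IsPseudoInstanton θ Γ I ∧ IsSimplePart I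

/-! ### The wave Ansatz -/

/-- A constant complex antisymmetric `L_ab` with `⋆(L_ab ϑ^ab) = α̃ i L_ab ϑ^ab`. -/
def IsPolarized (L : Fin 4 → Fin 4 → ℂ) (α' : ℝ) : Prop :=
  (∀ a b, L a b = - L b a) ∧ ∀ a b, star2 L a b = α' * Complex.I * L a b

/-- The plane wave `b = C e^{s i k (t + z)} (dx - i α dy)`. -/
def planeWave (C k s α : ℝ) (x : Pt) : Fin 4 → ℂ := fun μ =>
  C * Complex.exp (s * Complex.I * (k * (x 0 + x 3))) * ![0, 1, -(Complex.I * α), 0] μ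

/-- The contorsion `K_ab = Re(b L_ab)`. -/
def reContorsion (b : Pt → Fin 4 → ℂ) (L : Fin 4 → Fin 4 → ℂ) :
    Pt → Fin 4 → Fin 4 → Fin 4 → ℝ :=
  fun x μ a c => (b x μ * L a c).re

/-- The contorsion `K_{μνρ} = 2 Re(b_μ ∂_[ν b_ρ])`. -/
def waveContorsion (b : Pt → Fin 4 → ℂ) : Pt → Fin 4 → Fin 4 → Fin 4 → ℝ :=
  fun x μ ν σ =>
    2 * (b x μ * ((1 / 2) * (pd ν (fun y => b y σ) x - pd σ (fun y => b y ν) x))).re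

end MAG

end

open MAG

noncomputable section

namespace MAG

/-! A metric-compatible connection on Minkowski space is determined by its contorsion
(`connection_eq_of_hasContorsion`). Here it is `Re(ζ m ⊗ L)`, where `ζ` is a complex phase in `t +
z`, `m = dx - iα dy`, and `L` is a constant bivector that is an eigenvector of the Hodge dual.
Self-dual and anti-self-dual bivectors commute and are orthogonal, so `L` commutes with its
conjugate and `L · L̄ = 0` (`IsPolarized.isNullPair`). Commutation removes the quadratic term of the
curvature. Since `l = dt + dz` is null and orthogonal to `m`, the Yang–Mills expression vanishes
(`waveConnection_yangMills`), and the energy-momentum tensor is a multiple of `l ⊗ l` times `L ·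
L̄`, hence zero (`waveConnection_energyMomentum`).

Both Lagrangians have the form `ℓ(R) = B(R, R)` with `B` bilinear. If at the given curvature `V` the
differential `S ↦ B(V, S) + B(S, V)` is a multiple of `S ↦ pairing V S`, then the equations of
motion follow from the two facts above (`coframeEquation_of_energyMomentum`,
`connectionEquation_of_yangMills`). For `lagKV` this proportionality is the antisymmetry of `V`. For
the contorsion of (2), `L` is itself a multiple of `l ∧ m`, and the curvature is the real part of a
multiple of `(l ∧ m) ⊗ (l ∧ m)`, a type N Weyl tensor `nullWeyl`. Such a tensor satisfies the cyclic
identity and has no traces. So its other irreducible parts vanish, and it is orthogonal to the other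
parts of every curvature and to the mixing terms; only the coefficient `w 0` survives.

Simplicity of the Weyl part is a highest-weight argument. An equivariant isomorphism would carry a
type N Weyl tensor to a tensor in another part with the same eigenvalues under a boost, a quarter
turn and a null rotation. `eq_zero_of_highest_weight` shows that such a tensor is zero once it is
orthogonal to the opposite type N Weyl tensors. -/

/-! ### The Levi-Civita symbol and the Hodge dual of 2-forms. -/

/-- The Levi-Civita symbol as a polynomial in its indices. -/
theorem eps_mul_twelve (a b c d : Fin 4) :
    12 * eps a b c d = (((b : ℤ) - a) * (c - a) * (d - a) * (c - b) * (d - b) * (d - c) : ℤ) := by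
  -- With the determinant written out, the claim is an integer identity that can be decided for all
  -- 256 index tuples. The factor 12 is the Vandermonde product of 0, 1, 2, 3.
  have h : ∀ M : Fin 4 → Fin 4 → ℤ, Matrix.det (Matrix.of M) =
      M 0 0 * (M 1 1 * (M 2 2 * M 3 3 - M 2 3 * M 3 2) - M 1 2 * (M 2 1 * M 3 3 - M 2 3 * M 3 1)
        + M 1 3 * (M 2 1 * M 3 2 - M 2 2 * M 3 1))
      - M 0 1 * (M 1 0 * (M 2 2 * M 3 3 - M 2 3 * M 3 2) - M 1 2 * (M 2 0 * M 3 3 - M 2 3 * M 3 0)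
        + M 1 3 * (M 2 0 * M 3 2 - M 2 2 * M 3 0))
      + M 0 2 * (M 1 0 * (M 2 1 * M 3 3 - M 2 3 * M 3 1) - M 1 1 * (M 2 0 * M 3 3 - M 2 3 * M 3 0)
        + M 1 3 * (M 2 0 * M 3 1 - M 2 1 * M 3 0))
      - M 0 3 * (M 1 0 * (M 2 1 * M 3 2 - M 2 2 * M 3 1) - M 1 1 * (M 2 0 * M 3 2 - M 2 2 * M 3 0)
        + M 1 2 * (M 2 0 * M 3 1 - M 2 1 * M 3 0)) := by
    intro M
    simp [Matrix.det_succ_row_zero, Fin.sum_univ_succ, Fin.succAbove]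
    ring
  unfold eps
  rw [h]
  norm_cast
  revert a b c d
  decide

theorem eps_eq (a b c d : Fin 4) :
    eps a b c d =
      (1 / 12) * ((((b : ℤ) - a) * (c - a) * (d - a) * (c - b) * (d - b) * (d - c) : ℤ) : ℝ) := by
  rw [← eps_mul_twelve]; ring

theorem star2_apply {V : Type*} [AddCommGroup V] [Module ℝ V] (α : Fin 4 → Fin 4 → V)
    (c d : Fin 4) : star2 α c d = (1 / 2 : ℝ) •
      (![![0, α 2 3 - α 3 2, α 3 1 - α 1 3, α 1 2 - α 2 1],
        ![α 3 2 - α 2 3, 0, α 3 0 - α 0 3, α 0 2 - α 2 0],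
        ![α 1 3 - α 3 1, α 0 3 - α 3 0, 0, α 1 0 - α 0 1],
        ![α 2 1 - α 1 2, α 2 0 - α 0 2, α 0 1 - α 1 0, 0]] c d) := by
  unfold star2
  congr 1
  fin_cases c <;> fin_cases d <;>
    simp [Fin.sum_univ_four, eps_eq, eta] <;> norm_num <;> abel

/-- `Form2` does not build in antisymmetry, so only the antisymmetric parts of both factors enter.
The right-hand side is visibly symmetric in `α` and `β`, which makes `pairing` symmetric. -/
theorem wedge22_star2 (α β : Form2) : wedge22 α (star2 β) =
    (1 / 8) * ∑ c, ∑ d, eta c * eta d * ((α c d - α d c) * (β c d - β d c)) := by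
  unfold wedge22
  simp [Fin.sum_univ_four, eps_eq, eta, star2_apply]
  norm_num
  ring

/-! ### The pairing of curvature tensors -/

theorem pairing_comm (R S : Curv) : pairing R S = pairing S R := by
  simp only [pairing, wedge22_star2, mul_comm]

theorem pairing_eq_sum {V : Curv} (hV : IsTwoForm V) (S : Curv) :
    pairing V S = (1 / 2) * ∑ a, ∑ b, ∑ c, ∑ d,
      eta a * eta b * eta c * eta d * (V a b c d * S a b c d) := by
  have h : ∀ a b, wedge22 (V a b) (star2 (S a b)) =
      (1 / 2) * ∑ c, ∑ d, eta c * eta d * (V a b c d * S a b c d) := by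
    intro a b
    have h1 : ∑ c, ∑ d, eta c * eta d * (V a b d c * S a b d c) =
        ∑ c, ∑ d, eta c * eta d * (V a b c d * S a b c d) := by
      rw [Finset.sum_comm]
      simp only [mul_comm]
    have h2 : ∀ c d, eta c * eta d * ((V a b c d - V a b d c) * (S a b c d - S a b d c)) =
        2 * (eta c * eta d * (V a b c d * S a b c d)) +
        2 * (eta c * eta d * (V a b d c * S a b d c)) := by
      intro c d; rw [hV a b d c]; ring
    rw [wedge22_star2]
    simp only [h2, Finset.sum_add_distrib, ← Finset.mul_sum, h1]
    ring
  simp only [pairing, h, Finset.mul_sum]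
  refine Finset.sum_congr rfl fun a _ => Finset.sum_congr rfl fun b _ =>
    Finset.sum_congr rfl fun c _ => Finset.sum_congr rfl fun d _ => ?_
  ring

/-! ### Linearity -/

/-- The pairing as a bilinear map. -/
def pairingL : Curv →ₗ[ℝ] Curv →ₗ[ℝ] ℝ :=
  LinearMap.mk₂ ℝ pairing
    (fun R R' S => by
      simp only [pairing, wedge22, Pi.add_apply, mul_add, add_mul, Finset.sum_add_distrib])
    (fun c R S => by
      simp only [pairing, wedge22, Pi.smul_apply, smul_eq_mul, Finset.mul_sum]
      repeat refine Finset.sum_congr rfl fun _ _ => ?_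
      ring)
    (fun R S S' => by
      simp only [pairing, wedge22_star2, Pi.add_apply, add_sub_add_comm, mul_add,
        Finset.sum_add_distrib])
    (fun c R S => by
      simp only [pairing, wedge22_star2, Pi.smul_apply, smul_eq_mul, Finset.mul_sum]
      repeat refine Finset.sum_congr rfl fun _ _ => ?_
      ring)

/-- `Wof` as a linear map. -/
def WofL : Curv →ₗ[ℝ] Curv where
  toFun := Wof
  map_add' R S := by ext; simp [Wof]; ring
  map_smul' c R := by ext; simp [Wof]; ring

/-- `Zof` as a linear map. -/
def ZofL : Curv →ₗ[ℝ] Curv where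
  toFun := Zof
  map_add' R S := by ext; simp [Zof]; ring
  map_smul' c R := by ext; simp [Zof]; ring

/-- The Hodge dual in the form indices of a curvature tensor. -/
def starL : Curv →ₗ[ℝ] Curv where
  toFun R := fun a b => star2 (R a b)
  map_add' R S := by
    ext; simp [star2, mul_add, Finset.sum_add_distrib]
  map_smul' c R := by
    ext; simp only [star2, Pi.smul_apply, smul_eq_mul, Finset.mul_sum, RingHom.id_apply]
    repeat refine Finset.sum_congr rfl fun _ _ => ?_
    ring

/-- `contr` as a linear map. -/
def contrL : Curv →ₗ[ℝ] (Fin 4 → Form1) where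
  toFun := contr
  map_add' R S := by
    ext; simp [contr, int2, mul_add, Finset.sum_add_distrib]
  map_smul' c R := by
    ext; simp only [contr, int2, Finset.sum_apply, Pi.smul_apply, smul_eq_mul, Finset.mul_sum,
      RingHom.id_apply]
    repeat refine Finset.sum_congr rfl fun _ _ => ?_
    ring

/-- `contrBar` as a linear map. -/
def contrBarL : Curv →ₗ[ℝ] (Fin 4 → Form1) where
  toFun := contrBar
  map_add' R S := by
    ext; simp only [contrBar, star3, wedge21, Finset.sum_apply, Pi.add_apply, Finset.mul_sum,
      ← Finset.sum_add_distrib]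
    repeat refine Finset.sum_congr rfl fun _ _ => ?_
    ring
  map_smul' c R := by
    ext; simp only [contrBar, star3, wedge21, Finset.sum_apply, Pi.smul_apply, smul_eq_mul,
      Finset.mul_sum, RingHom.id_apply]
    repeat refine Finset.sum_congr rfl fun _ _ => ?_
    ring

/-- `trace1` as a linear map. -/
def trace1L : (Fin 4 → Form1) →ₗ[ℝ] ℝ where
  toFun := trace1
  map_add' R S := by simp [trace1, mul_add, Finset.sum_add_distrib]
  map_smul' c R := by
    simp only [trace1, Pi.smul_apply, smul_eq_mul, Finset.mul_sum, RingHom.id_apply]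
    repeat refine Finset.sum_congr rfl fun _ _ => ?_
    ring

/-- `antis` as a linear map. -/
def antisL : (Fin 4 → Form1) →ₗ[ℝ] Form2 where
  toFun := antis
  map_add' R S := by
    ext; simp only [antis, wedge11, Finset.sum_apply, Pi.add_apply, ← Finset.sum_add_distrib]
    repeat refine Finset.sum_congr rfl fun _ _ => ?_
    ring
  map_smul' c R := by
    ext; simp only [antis, wedge11, Finset.sum_apply, Pi.smul_apply, smul_eq_mul, Finset.mul_sum,
      RingHom.id_apply]
    repeat refine Finset.sum_congr rfl fun _ _ => ?_
    ring

/-- `thetaAlt` as a linear map. -/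
def thetaAltL : (Fin 4 → Form1) →ₗ[ℝ] Curv where
  toFun := thetaAlt
  map_add' R S := by ext; simp [thetaAlt, wedge11]; ring
  map_smul' c R := by ext; simp [thetaAlt, wedge11]; ring

/-- `thetaSym` as a linear map. -/
def thetaSymL : (Fin 4 → Form1) →ₗ[ℝ] Curv where
  toFun := thetaSym
  map_add' R S := by ext; simp [thetaSym, wedge11]; ring
  map_smul' c R := by ext; simp [thetaSym, wedge11]; ring

/-- `ξ ↦ e_a ⌟ (ϑ^b ∧ ξ_b)` as a linear map. -/
def intAntisL : (Fin 4 → Form1) →ₗ[ℝ] (Fin 4 → Form1) where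
  toFun ξ := fun a => int2 a (antisL ξ)
  map_add' R S := by rw [map_add]; rfl
  map_smul' c R := by rw [map_smul]; rfl

/-- `ξ ↦ ξ - ¼ (e_a ⌟ ξ^a) ϑ - ½ e ⌟ (ϑ^b ∧ ξ_b)` as a linear map. -/
def psiL : (Fin 4 → Form1) →ₗ[ℝ] (Fin 4 → Form1) :=
  LinearMap.id - ((1 / 4 : ℝ) • trace1L).smulRight theta - (1 / 2 : ℝ) • intAntisL

/-- `ξ ↦ ξ - ½ e ⌟ (ϑ^b ∧ ξ_b)` as a linear map. -/
def phiL : (Fin 4 → Form1) →ₗ[ℝ] (Fin 4 → Form1) := LinearMap.id - (1 / 2 : ℝ) • intAntisL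

/-- The trace part of `Z_ab` as a linear map. -/
def Z5L : Curv →ₗ[ℝ] Curv where
  toFun := Z5
  map_add' R S := by
    ext; simp [Z5, Zof, mul_add, Finset.sum_add_distrib]; ring
  map_smul' c R := by
    ext a b i j
    simp only [Z5, Zof, Finset.sum_apply, Pi.smul_apply, Pi.add_apply, smul_eq_mul,
      Finset.mul_sum, RingHom.id_apply]
    repeat refine Finset.sum_congr rfl fun _ _ => ?_
    ring

/-- `Y` as a linear map. -/
def YL : Curv →ₗ[ℝ] (Fin 4 → Form1) := contrL ∘ₗ (ZofL - Z5L)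

/-- `Ȳ` as a linear map. -/
def YbarL : Curv →ₗ[ℝ] (Fin 4 → Form1) := contrBarL ∘ₗ (ZofL - Z5L)

/-- `X` as a linear map. -/
def XL : Curv →ₗ[ℝ] (Fin 4 → Form1) := contrL ∘ₗ WofL

/-- `X̄` as a linear map. -/
def XbarL : Curv →ₗ[ℝ] (Fin 4 → Form1) := contrBarL ∘ₗ WofL

/-- Brings the two scalar parts into the common shape: each of `W2`, …, `W6` is in the range of
`thetaAlt` or in that of its Hodge dual, so orthogonality needs to be checked only there. -/
theorem wedge11_theta (a b : Fin 4) : wedge11 (theta a) (theta b) = thetaAlt theta a b := by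
  ext c d; simp [thetaAlt, wedge11]; ring

/-- The second part of `W_ab` as a linear map. -/
def W2L : Curv →ₗ[ℝ] Curv := -(starL ∘ₗ thetaAltL ∘ₗ psiL ∘ₗ XbarL)

/-- The third part of `W_ab` as a linear map. -/
def W3L : Curv →ₗ[ℝ] Curv :=
  ((-(1 / 12) : ℝ) • (trace1L ∘ₗ XbarL)).smulRight (starL (thetaAltL theta))

/-- The fourth part of `W_ab` as a linear map. -/
def W4L : Curv →ₗ[ℝ] Curv := -(thetaAltL ∘ₗ psiL ∘ₗ XL)

/-- The fifth part of `W_ab` as a linear map. -/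
def W5L : Curv →ₗ[ℝ] Curv := (-(1 / 2) : ℝ) • (thetaAltL ∘ₗ intAntisL ∘ₗ XL)

/-- The sixth part of `W_ab` as a linear map. -/
def W6L : Curv →ₗ[ℝ] Curv :=
  ((-(1 / 12) : ℝ) • (trace1L ∘ₗ XL)).smulRight (thetaAltL theta)

theorem W2L_apply (R : Curv) : W2L R = W2 R := by
  have : Psibar R = psiL (XbarL R) := rfl
  ext a b; simp only [W2, this]; rfl

theorem W3L_apply (R : Curv) : W3L R = W3 R := by
  ext a b; simp only [W3, wedge11_theta]; rfl

theorem W4L_apply (R : Curv) : W4L R = W4 R := rfl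

theorem W5L_apply (R : Curv) : W5L R = W5 R := rfl

theorem W6L_apply (R : Curv) : W6L R = W6 R := by
  ext a b; simp only [W6, wedge11_theta]; rfl

/-- `α ↦ g_ab α` as a linear map. -/
def metricL : Form2 →ₗ[ℝ] Curv where
  toFun α := fun a b => metric a b • α
  map_add' R S := by ext; simp; ring
  map_smul' c R := by ext; simp; ring

/-- The second part of `Z_ab` as a linear map. -/
def Z2L : Curv →ₗ[ℝ] Curv := (-(1 / 2) : ℝ) • (starL ∘ₗ thetaSymL ∘ₗ phiL ∘ₗ YbarL)

/-- The third part of `Z_ab` as a linear map. -/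
def Z3L : Curv →ₗ[ℝ] Curv := (1 / 12 : ℝ) • ((4 : ℝ) • (thetaSymL ∘ₗ intAntisL ∘ₗ YL)
  - (2 : ℝ) • (metricL ∘ₗ antisL ∘ₗ YL))

/-- The fourth part of `Z_ab` as a linear map. -/
def Z4L : Curv →ₗ[ℝ] Curv := (1 / 2 : ℝ) • (thetaSymL ∘ₗ phiL ∘ₗ YL)

theorem Z2L_apply (R : Curv) : Z2L R = Z2 R := rfl

theorem Z3L_apply (R : Curv) : Z3L R = Z3 R := by
  ext a b c d
  have h1 : (metricL (antisL (YL R))) a b c d = metric a b * antis (Y R) c d := rfl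
  have h2 : (thetaSymL (intAntisL (YL R))) a b c d =
      thetaSym (fun b => int2 b (antis (Y R))) a b c d := rfl
  simp [Z3, Z3L, h1, h2]; ring

theorem Z4L_apply (R : Curv) : Z4L R = Z4 R := rfl

/-- The first part of `W_ab` as a linear map. -/
def W1L : Curv →ₗ[ℝ] Curv := WofL - (W2L + W3L + W4L + W5L + W6L)

/-- The first part of `Z_ab` as a linear map. -/
def Z1L : Curv →ₗ[ℝ] Curv := ZofL - (Z2L + Z3L + Z4L + Z5L)

theorem W1L_apply (R : Curv) : W1L R = W1 R := by
  simp only [W1L, W1, LinearMap.sub_apply, LinearMap.add_apply, W2L_apply, W3L_apply, W4L_apply,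
    W5L_apply, W6L_apply]; rfl

theorem Z1L_apply (R : Curv) : Z1L R = Z1 R := by
  simp only [Z1L, Z1, LinearMap.sub_apply, LinearMap.add_apply, Z2L_apply, Z3L_apply, Z4L_apply]
  rfl

/-- The irreducible parts of the curvature as linear maps. -/
def partL : PartIdx → Curv →ₗ[ℝ] Curv
  | .inl I => ![W1L, W2L, W3L, W4L, W5L, W6L] I
  | .inr I => ![Z1L, Z2L, Z3L, Z4L, Z5L] I

theorem partL_apply (I : PartIdx) (R : Curv) : partL I R = part I R := by
  rcases I with I | I <;> fin_cases I
  · exact W1L_apply R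
  · exact W2L_apply R
  · exact W3L_apply R
  · exact W4L_apply R
  · exact W5L_apply R
  · exact W6L_apply R
  · exact Z1L_apply R
  · exact Z2L_apply R
  · exact Z3L_apply R
  · exact Z4L_apply R
  · rfl

/-- `mixA` as a linear map. -/
def mixAL : Curv →ₗ[ℝ] Curv where
  toFun := mixA
  map_add' R S := by
    ext; simp [mixA, wedge11, int2, mul_add, Finset.sum_add_distrib]; ring
  map_smul' c R := by
    ext a b i j
    simp only [mixA, wedge11, int2, Finset.sum_apply, Pi.smul_apply, smul_eq_mul,
      mul_left_comm _ c, ← Finset.mul_sum, RingHom.id_apply]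
    ring

/-- `mixB` as a linear map. -/
def mixBL : Curv →ₗ[ℝ] Curv where
  toFun := mixB
  map_add' R S := by
    ext; simp only [mixB, wedge11, int2, Finset.sum_apply, Pi.add_apply, ← Finset.sum_add_distrib]
    repeat refine Finset.sum_congr rfl fun _ _ => ?_
    ring
  map_smul' c R := by
    ext a b i j
    simp only [mixB, wedge11, int2, Finset.sum_apply, Pi.smul_apply, smul_eq_mul,
      Finset.mul_sum, RingHom.id_apply]
    repeat refine Finset.sum_congr rfl fun _ _ => ?_
    ring

/-- The linear map in the strong-sector Lagrangian. -/
def strongL (w : Fin 6 → ℝ) (z v : Fin 5 → ℝ) : Curv →ₗ[ℝ] Curv :=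
  (∑ I, w I • partL (.inl I)) + v 0 • (mixAL ∘ₗ W5L) + (∑ I, z I • partL (.inr I))
    + v 1 • (mixBL ∘ₗ Z2L)
    + (v 2 • (mixAL ∘ₗ Z3L) + v 3 • (mixAL ∘ₗ Z4L) + v 4 • (mixAL ∘ₗ Z5L))

theorem lagStrong_eq (ρ : ℝ) (w : Fin 6 → ℝ) (z v : Fin 5 → ℝ) (R : Curv) :
    lagStrong ρ w z v R = -(1 / (2 * ρ)) * pairing R (strongL w z v R) := by
  have hA : ∀ S, mixAL S = mixA S := fun _ => rfl
  have hB : ∀ S, mixBL S = mixB S := fun _ => rfl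
  have hZ5 : Z5L R = Z5 R := rfl
  simp only [lagStrong, strongL, LinearMap.add_apply, LinearMap.smul_apply, LinearMap.sum_apply,
    partL_apply, LinearMap.comp_apply, hA, hB, W5L_apply, Z2L_apply, Z3L_apply, Z4L_apply, hZ5]
  rfl

/-! ### Weyl tensors of type N -/

/-- The null 1-form `dt + τ dz`. -/
def nullForm (τ : ℝ) : Form1 := ![1, 0, 0, τ]

/-- The 2-form `(dt + τ dz) ∧ dx`. -/
def nullX (τ : ℝ) : Form2 := wedge11 (nullForm τ) ![0, 1, 0, 0]

/-- The 2-form `(dt + τ dz) ∧ dy`. -/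
def nullY (τ : ℝ) : Form2 := wedge11 (nullForm τ) ![0, 0, 1, 0]

/-- The Weyl tensors with fourfold null direction `dt + τ dz`. -/
def nullWeyl (τ p q : ℝ) : Curv := fun a b c d =>
  p * (nullX τ a b * nullX τ c d - nullY τ a b * nullY τ c d)
    + q * (nullX τ a b * nullY τ c d + nullY τ a b * nullX τ c d)

theorem nullX_eq (τ : ℝ) (a b : Fin 4) : nullX τ a b =
    ![![0, 1, 0, 0], ![-1, 0, 0, -τ], ![0, 0, 0, 0], ![0, τ, 0, 0]] a b := by
  fin_cases a <;> fin_cases b <;> simp [nullX, wedge11, nullForm]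

theorem nullY_eq (τ : ℝ) (a b : Fin 4) : nullY τ a b =
    ![![0, 0, 1, 0], ![0, 0, 0, 0], ![-1, 0, 0, -τ], ![0, 0, τ, 0]] a b := by
  fin_cases a <;> fin_cases b <;> simp [nullY, wedge11, nullForm]

theorem wedge11_antisymm (α β : Form1) (c d : Fin 4) : wedge11 α β c d = -wedge11 α β d c := by
  simp only [wedge11]; ring

theorem nullX_antisymm (τ : ℝ) (c d : Fin 4) : nullX τ c d = -nullX τ d c :=
  wedge11_antisymm _ _ _ _

theorem nullY_antisymm (τ : ℝ) (c d : Fin 4) : nullY τ c d = -nullY τ d c :=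
  wedge11_antisymm _ _ _ _

theorem nullWeyl_isTwoForm (τ p q : ℝ) : IsTwoForm (nullWeyl τ p q) := by
  intro a b c d
  simp only [nullWeyl]
  rw [nullX_antisymm τ c d, nullY_antisymm τ c d]; ring

theorem nullWeyl_antisymm (τ p q : ℝ) (a b c d : Fin 4) :
    nullWeyl τ p q a b c d = -nullWeyl τ p q b a c d := by
  simp only [nullWeyl]
  rw [nullX_antisymm τ a b, nullY_antisymm τ a b]; ring

theorem Wof_nullWeyl (τ p q : ℝ) : Wof (nullWeyl τ p q) = nullWeyl τ p q := by
  ext a b c d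
  simp only [Wof, Pi.smul_apply, Pi.sub_apply, smul_eq_mul]
  rw [nullWeyl_antisymm τ p q b a]; ring

theorem Zof_nullWeyl (τ p q : ℝ) : Zof (nullWeyl τ p q) = 0 := by
  ext a b c d
  simp only [Zof, Pi.smul_apply, Pi.add_apply, smul_eq_mul, Pi.zero_apply]
  rw [nullWeyl_antisymm τ p q b a]; ring

/-- The contraction leaves the square of `dt + τ dz`, zero for `τ² = 1`, its products with `dx` and
`dy`, also zero, and the trace of the transverse matrix with entries `p, q, q, -p`. -/
theorem contr_nullWeyl {τ : ℝ} (hτ : τ ^ 2 = 1) (p q : ℝ) : contr (nullWeyl τ p q) = 0 := by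
  ext a d
  simp only [contr, int2, Finset.sum_apply, Pi.smul_apply, smul_eq_mul, Fin.sum_univ_four,
    nullWeyl, nullX_eq, nullY_eq, Pi.zero_apply]
  fin_cases a <;> fin_cases d <;> simp [eta] <;> ring_nf <;> simp [hτ]

/-- The cyclic sum of a symmetric product of bivectors is their exterior product, and `nullX ∧
nullX`, `nullY ∧ nullY` and `nullX ∧ nullY` vanish because all share the factor `dt + τ dz`. -/
theorem nullWeyl_cyclic (τ p q : ℝ) (a c d e : Fin 4) :
    nullWeyl τ p q a c d e + nullWeyl τ p q a d e c + nullWeyl τ p q a e c d = 0 := by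
  simp only [nullWeyl, nullX, nullY, wedge11]; ring

theorem contrBar_nullWeyl (τ p q : ℝ) : contrBar (nullWeyl τ p q) = 0 := by
  ext a d
  have : ∑ b, wedge21 (nullWeyl τ p q b a) (thetaUp b) = 0 := by
    ext c d e
    simp only [wedge21, thetaUp, Finset.sum_apply, mul_ite, mul_one, mul_zero,
      Finset.sum_add_distrib, Finset.sum_ite_eq, Finset.mem_univ, if_true, Pi.zero_apply]
    rw [nullWeyl_antisymm τ p q e a, nullWeyl_antisymm τ p q c a, nullWeyl_antisymm τ p q d a]
    linarith [nullWeyl_cyclic τ p q a e c d]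
  rw [contrBar, this]; simp [star3]

/-- The dual acts as `⋆nullX = τ nullY` and `⋆nullY = -τ nullX`. Type N tensors with a fixed null
direction are therefore stable under duality, so orthogonality to a space of tensors gives
orthogonality to its dual. -/
theorem star_nullWeyl {τ : ℝ} (hτ : τ ^ 2 = 1) (p q : ℝ) :
    starL (nullWeyl τ p q) = nullWeyl τ (-τ * q) (τ * p) := by
  ext a b c d
  change star2 (nullWeyl τ p q a b) c d = _
  rw [star2_apply]
  simp only [nullWeyl, nullX_eq τ _ _, nullY_eq τ _ _]
  generalize ![![0, 1, 0, 0], ![-1, 0, 0, -τ], ![0, 0, 0, 0], ![0, τ, 0, 0]] a b = u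
  generalize ![![0, 0, 1, 0], ![0, 0, 0, 0], ![-1, 0, 0, -τ], ![0, 0, τ, 0]] a b = v
  fin_cases c <;> fin_cases d <;> simp <;> ring_nf <;> (try simp [hτ])

theorem pairing_nullWeyl (τ p q : ℝ) (S : Curv) : pairing (nullWeyl τ p q) S =
    (1 / 2) * ∑ a, ∑ b, eta a * eta b * (
      nullX τ a b * ∑ c, ∑ d, eta c * eta d * ((p * nullX τ c d + q * nullY τ c d) * S a b c d)
      + nullY τ a b * ∑ c, ∑ d, eta c * eta d * ((q * nullX τ c d - p * nullY τ c d) * S a b c d))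
      := by
  rw [pairing_eq_sum (nullWeyl_isTwoForm τ p q)]
  simp only [Finset.mul_sum, ← Finset.sum_add_distrib, nullWeyl]
  repeat refine Finset.sum_congr rfl fun _ _ => ?_
  ring

/-- Pairing with `ϑ_a ∧ ξ_b` contracts an external with a form index and so produces the trace of
the Weyl tensor, which vanishes. -/
theorem pairing_nullWeyl_theta {τ : ℝ} (hτ : τ ^ 2 = 1) (p q : ℝ) (ξ : Fin 4 → Form1) :
    pairing (nullWeyl τ p q) (fun a b => wedge11 (theta a) (ξ b)) = 0 := by
  rw [pairing_nullWeyl]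
  simp [Fin.sum_univ_four, nullX_eq, nullY_eq, eta, wedge11, theta, metric]
  ring_nf
  simp [hτ]

theorem pairing_neg_right (R S : Curv) : pairing R (-S) = -pairing R S := (pairingL R).map_neg S

theorem pairing_neg_left (R S : Curv) : pairing (-R) S = -pairing R S := by
  rw [pairing_comm, pairing_neg_right, pairing_comm]

theorem pairing_add_right (R S T : Curv) : pairing R (S + T) = pairing R S + pairing R T :=
  (pairingL R).map_add S T

theorem pairing_sub_right (R S T : Curv) : pairing R (S - T) = pairing R S - pairing R T :=
  (pairingL R).map_sub S T

theorem pairing_smul_right (R S : Curv) (c : ℝ) : pairing R (c • S) = c * pairing R S :=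
  (pairingL R).map_smul c S

theorem pairing_sum_right {ι : Type*} (s : Finset ι) (R : Curv) (S : ι → Curv) :
    pairing R (∑ i ∈ s, S i) = ∑ i ∈ s, pairing R (S i) := map_sum (pairingL R) S s

theorem pairing_transpose (R S : Curv) :
    pairing (fun a b => R b a) (fun a b => S b a) = pairing R S := by
  simp only [pairing]
  rw [Finset.sum_comm]
  refine Finset.sum_congr rfl fun a _ => Finset.sum_congr rfl fun b _ => ?_
  rw [mul_comm (eta b)]

theorem pairing_transpose_of_antisymm {V : Curv} (hV : ∀ a b, V a b = -V b a) (S : Curv) :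
    pairing V (fun a b => S b a) = -pairing V S := by
  have : V = -(fun a b => V b a) := by ext a b : 2; exact hV a b
  conv_lhs => rw [this]
  rw [pairing_neg_left, pairing_transpose]

theorem pairing_nullWeyl_transpose (τ p q : ℝ) (S : Curv) :
    pairing (nullWeyl τ p q) (fun a b => S b a) = -pairing (nullWeyl τ p q) S :=
  pairing_transpose_of_antisymm
    (fun a b => by ext c d; exact nullWeyl_antisymm _ _ _ _ _ _ _) S

theorem pairing_nullWeyl_symm {τ p q : ℝ} {S : Curv} (hS : ∀ a b, S a b = S b a) :
    pairing (nullWeyl τ p q) S = 0 := by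
  have h := pairing_nullWeyl_transpose τ p q S
  have : (fun a b => S b a) = S := by ext a b : 2; exact hS b a
  rw [this] at h; linarith

theorem pairing_nullWeyl_thetaAlt {τ : ℝ} (hτ : τ ^ 2 = 1) (p q : ℝ) (ξ : Fin 4 → Form1) :
    pairing (nullWeyl τ p q) (thetaAlt ξ) = 0 := by
  have h1 := pairing_nullWeyl_theta hτ p q ξ
  have h2 := pairing_nullWeyl_transpose τ p q (fun a b => wedge11 (theta a) (ξ b))
  have : thetaAlt ξ = (1 / 2 : ℝ) • ((fun a b => wedge11 (theta a) (ξ b)) -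
    fun a b => wedge11 (theta b) (ξ a)) := rfl
  rw [this, pairing_smul_right, pairing_sub_right, h2, h1]; simp

theorem pairing_starL (R S : Curv) : pairing R (starL S) = pairing (starL R) S := by
  simp only [pairing]
  refine Finset.sum_congr rfl fun a _ => Finset.sum_congr rfl fun b _ => ?_
  change _ * wedge22 (R a b) (star2 (star2 (S a b))) =
    _ * wedge22 (star2 (R a b)) (star2 (S a b))
  congr 1
  rw [wedge22_star2, wedge22_star2]
  generalize R a b = α
  generalize S a b = β
  have h : ∀ c, star2 α c c = 0 ∧ star2 β c c = 0 := fun c => by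
    constructor <;> rw [star2_apply] <;> fin_cases c <;> simp
  simp only [Fin.sum_univ_four, h]
  simp only [star2_apply]
  simp [eta]
  ring

theorem pairing_nullWeyl_star_thetaAlt {τ : ℝ} (hτ : τ ^ 2 = 1) (p q : ℝ) (ξ : Fin 4 → Form1) :
    pairing (nullWeyl τ p q) (starL (thetaAltL ξ)) = 0 := by
  rw [pairing_starL, star_nullWeyl hτ]
  exact pairing_nullWeyl_thetaAlt hτ _ _ ξ

theorem thetaSym_symm (ξ : Fin 4 → Form1) (a b : Fin 4) : thetaSym ξ a b = thetaSym ξ b a := by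
  simp only [thetaSym, add_comm]

theorem Zof_symm (R : Curv) (a b : Fin 4) : Zof R a b = Zof R b a := by
  simp only [Zof, add_comm]

theorem metric_symm (a b : Fin 4) : metric a b = metric b a := by
  unfold metric
  by_cases h : a = b
  · simp [h]
  · simp [h, Ne.symm h]

theorem Zpart_symm (I : Fin 5) (R : Curv) (a b : Fin 4) : Zpart I R a b = Zpart I R b a := by
  have h2 : Z2 R a b = Z2 R b a := by simp only [Z2, thetaSym_symm _ a b]
  have h3 : Z3 R a b = Z3 R b a := by simp only [Z3, thetaSym_symm _ a b, metric_symm a b]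
  have h4 : Z4 R a b = Z4 R b a := by
    simp only [Z4, Pi.smul_apply, thetaSym_symm _ a b]
  have h5 : Z5 R a b = Z5 R b a := by simp only [Z5, metric_symm a b]
  fin_cases I
  · change Z1 R a b = Z1 R b a
    simp only [Z1, Pi.sub_apply, Pi.add_apply, h2, h3, h4, h5, Zof_symm R a b]
  · exact h2
  · exact h3
  · exact h4
  · exact h5

theorem pairing_nullWeyl_Wpart {τ : ℝ} (hτ : τ ^ 2 = 1) (p q : ℝ) (R : Curv) :
    pairing (nullWeyl τ p q) (W2 R) = 0 ∧ pairing (nullWeyl τ p q) (W3 R) = 0 ∧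
    pairing (nullWeyl τ p q) (W4 R) = 0 ∧ pairing (nullWeyl τ p q) (W5 R) = 0 ∧
    pairing (nullWeyl τ p q) (W6 R) = 0 := by
  have h := pairing_nullWeyl_thetaAlt hτ p q
  have h' : ∀ ξ, pairing (nullWeyl τ p q) (thetaAltL ξ) = 0 := h
  have hs := pairing_nullWeyl_star_thetaAlt hτ p q
  refine ⟨?_, ?_, ?_, ?_, ?_⟩
  · rw [← W2L_apply, W2L, LinearMap.neg_apply, LinearMap.comp_apply, LinearMap.comp_apply,
      pairing_neg_right, hs, neg_zero]
  · rw [← W3L_apply, W3L, LinearMap.smulRight_apply, pairing_smul_right, hs, mul_zero]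
  · rw [W4, pairing_neg_right, h, neg_zero]
  · rw [W5, pairing_smul_right, h, mul_zero]
  · rw [← W6L_apply, W6L, LinearMap.smulRight_apply, pairing_smul_right, h', mul_zero]

/-- The type N Weyl tensors are orthogonal to all irreducible parts but the Weyl part. -/
theorem pairing_nullWeyl_part {τ : ℝ} (hτ : τ ^ 2 = 1) (p q : ℝ) {J : PartIdx} (hJ : J ≠ weyl)
    (R : Curv) : pairing (nullWeyl τ p q) (part J R) = 0 := by
  obtain ⟨h2, h3, h4, h5, h6⟩ := pairing_nullWeyl_Wpart hτ p q R
  rcases J with J | J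
  · fin_cases J
    · exact absurd rfl hJ
    · exact h2
    · exact h3
    · exact h4
    · exact h5
    · exact h6
  · exact pairing_nullWeyl_symm (Zpart_symm J R)

/-- What `W1 R` omits from `R` is the symmetric part and `W2 R`, …, `W6 R`, all orthogonal to
`nullWeyl`. -/
theorem pairing_nullWeyl_W1 {τ : ℝ} (hτ : τ ^ 2 = 1) (p q : ℝ) (R : Curv) :
    pairing (nullWeyl τ p q) (W1 R) = pairing (nullWeyl τ p q) R := by
  obtain ⟨h2, h3, h4, h5, h6⟩ := pairing_nullWeyl_Wpart hτ p q R
  have : Wof R = (1 / 2 : ℝ) • (R - fun a b => R b a) := rfl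
  rw [W1, pairing_sub_right, pairing_add_right, pairing_add_right, pairing_add_right,
    pairing_add_right, h2, h3, h4, h5, h6, this, pairing_smul_right, pairing_sub_right,
    pairing_nullWeyl_transpose]
  ring

theorem pairing_nullWeyl_mixA {τ : ℝ} (hτ : τ ^ 2 = 1) (p q : ℝ) (S : Curv) :
    pairing (nullWeyl τ p q) (mixA S) = 0 :=
  pairing_nullWeyl_theta hτ p q _

theorem sum_swap₁₃ {M : Type*} [AddCommMonoid M] (f : Fin 4 → Fin 4 → Fin 4 → M) :
    ∑ a, ∑ b, ∑ c, f a b c = ∑ a, ∑ b, ∑ c, f c b a := by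
  rw [Finset.sum_comm]
  conv_rhs => rw [Finset.sum_comm]
  exact Finset.sum_congr rfl fun b _ => Finset.sum_comm

theorem sum_swap₁₄ {M : Type*} [AddCommMonoid M] (f : Fin 4 → Fin 4 → Fin 4 → Fin 4 → M) :
    ∑ a, ∑ b, ∑ c, ∑ d, f a b c d = ∑ a, ∑ b, ∑ c, ∑ d, f d b c a := by
  have h : ∀ g : Fin 4 → Fin 4 → Fin 4 → Fin 4 → M,
      ∑ a, ∑ b, ∑ c, ∑ d, g a b c d = ∑ a, ∑ b, ∑ c, ∑ d, g a b d c := fun g =>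
    Finset.sum_congr rfl fun _ _ => Finset.sum_congr rfl fun _ _ => Finset.sum_comm
  rw [sum_swap₁₃ fun a b c => ∑ d, f a b c d, h, sum_swap₁₃ fun a b c => ∑ d, f d b a c, h]

theorem star2_antisymm (α : Form2) (c d : Fin 4) : star2 α c d = -star2 α d c := by
  rw [star2_apply, star2_apply]
  fin_cases c <;> fin_cases d <;> simp <;> ring

/-- The pairing is the crossed contraction of `V a b c d` with `S c b a d`. By the cyclic identity
of `V` and the antisymmetry of `S` in its form indices, twice this number is the full contraction of
`V` with `S`, which is zero because `V` is antisymmetric and `S` symmetric in the external indices.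
-/
theorem pairing_nullWeyl_mixB (τ p q : ℝ) {S : Curv} (hS : ∀ a b, S a b = S b a)
    (hS' : IsTwoForm S) : pairing (nullWeyl τ p q) (mixB S) = 0 := by
  have hV := nullWeyl_isTwoForm τ p q
  have h1 := pairing_nullWeyl_symm (τ := τ) (p := p) (q := q) hS
  rw [pairing_eq_sum hV] at h1 ⊢
  set V := nullWeyl τ p q
  have e1 : ∑ a, ∑ b, ∑ c, ∑ d, eta a * eta b * eta c * eta d * (V a b c d * mixB S a b c d) =
      (∑ a, ∑ b, ∑ c, ∑ d, eta a * eta b * eta c * eta d * (V a b c d * S c b a d)) +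
      ∑ a, ∑ b, ∑ c, ∑ d, eta a * eta b * eta d * eta c * (V a b d c * S d b a c) := by
    simp only [← Finset.sum_add_distrib]
    refine Finset.sum_congr rfl fun a _ => Finset.sum_congr rfl fun b _ =>
      Finset.sum_congr rfl fun c _ => Finset.sum_congr rfl fun d _ => ?_
    simp only [mixB, wedge11, thetaUp, int2, Finset.sum_apply, ite_mul, one_mul, zero_mul,
      Finset.sum_sub_distrib, Finset.sum_ite_eq, Finset.mem_univ, if_true]
    rw [hV a b d c]; ring
  have e2 : ∑ a, ∑ b, ∑ c, ∑ d, eta a * eta b * eta d * eta c * (V a b d c * S d b a c) =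
      ∑ a, ∑ b, ∑ c, ∑ d, eta a * eta b * eta c * eta d * (V a b c d * S c b a d) :=
    Finset.sum_congr rfl fun a _ => Finset.sum_congr rfl fun b _ => Finset.sum_comm
  have e3 := sum_swap₁₄ fun a b c d => eta a * eta b * eta c * eta d * (V a b c d * S c b a d)
  have e4 := sum_swap₁₃ fun a b c => ∑ d, eta a * eta b * eta c * eta d * (V a b c d * S a b c d)
  -- The two sums on the left are equal by `e3`; the cyclic identity combines their `V` factors into
  -- `V c b a d`.
  have e5 : (∑ a, ∑ b, ∑ c, ∑ d, eta a * eta b * eta c * eta d * (V a b c d * S c b a d)) +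
      ∑ a, ∑ b, ∑ c, ∑ d, eta d * eta b * eta c * eta a * (V d b c a * S c b d a) =
      ∑ a, ∑ b, ∑ c, ∑ d, eta c * eta b * eta a * eta d * (V c b a d * S c b a d) := by
    simp only [← Finset.sum_add_distrib]
    refine Finset.sum_congr rfl fun a _ => Finset.sum_congr rfl fun b _ =>
      Finset.sum_congr rfl fun c _ => Finset.sum_congr rfl fun d _ => ?_
    have h := nullWeyl_cyclic τ p q b a c d
    have h' : V a b c d - V d b c a = V c b a d := by
      simp only [V]
      rw [nullWeyl_antisymm τ p q a b, nullWeyl_antisymm τ p q d b, nullWeyl_antisymm τ p q c b,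
        nullWeyl_isTwoForm τ p q b d c a, nullWeyl_isTwoForm τ p q b c a d]
      linarith
    rw [hS' c b d a, ← h']; ring
  linarith

/-! ### Irreducible parts of a type N Weyl tensor -/

theorem WofL_nullWeyl (τ p q : ℝ) : WofL (nullWeyl τ p q) = nullWeyl τ p q := Wof_nullWeyl τ p q

theorem ZofL_nullWeyl (τ p q : ℝ) : ZofL (nullWeyl τ p q) = 0 := Zof_nullWeyl τ p q

theorem Z5L_nullWeyl (τ p q : ℝ) : Z5L (nullWeyl τ p q) = 0 := by
  ext a b : 2
  change ((1 / 4) * metric a b) • ∑ c, eta c • Zof (nullWeyl τ p q) c c = 0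
  simp [Zof_nullWeyl]

theorem XL_nullWeyl {τ : ℝ} (hτ : τ ^ 2 = 1) (p q : ℝ) : XL (nullWeyl τ p q) = 0 := by
  rw [XL, LinearMap.comp_apply, WofL_nullWeyl]; exact contr_nullWeyl hτ p q

theorem XbarL_nullWeyl (τ p q : ℝ) : XbarL (nullWeyl τ p q) = 0 := by
  rw [XbarL, LinearMap.comp_apply, WofL_nullWeyl]; exact contrBar_nullWeyl τ p q

theorem YL_nullWeyl (τ p q : ℝ) : YL (nullWeyl τ p q) = 0 := by
  rw [YL, LinearMap.comp_apply, LinearMap.sub_apply, ZofL_nullWeyl, Z5L_nullWeyl, sub_zero,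
    map_zero]

theorem YbarL_nullWeyl (τ p q : ℝ) : YbarL (nullWeyl τ p q) = 0 := by
  rw [YbarL, LinearMap.comp_apply, LinearMap.sub_apply, ZofL_nullWeyl, Z5L_nullWeyl, sub_zero,
    map_zero]

/-- Each of these parts is built from `X`, `X̄`, `Y`, `Ȳ`, `Zof` and `Z5`, all of which vanish here.
-/
theorem partL_nullWeyl {τ : ℝ} (hτ : τ ^ 2 = 1) (p q : ℝ) {J : PartIdx} (hJ : J ≠ weyl) :
    partL J (nullWeyl τ p q) = 0 := by
  have hX := XL_nullWeyl hτ p q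
  have hXb := XbarL_nullWeyl τ p q
  have hY := YL_nullWeyl τ p q
  have hYb := YbarL_nullWeyl τ p q
  rcases J with J | J <;> fin_cases J
  · exact absurd rfl hJ
  · change W2L _ = 0
    simp [W2L, hXb]
  · change W3L _ = 0
    simp [W3L, hXb]
  · change W4L _ = 0
    simp [W4L, hX]
  · change W5L _ = 0
    simp [W5L, hX]
  · change W6L _ = 0
    simp [W6L, hX]
  · change Z1L _ = 0
    simp [Z1L, Z2L, Z3L, Z4L, hY, hYb, ZofL_nullWeyl, Z5L_nullWeyl]
  · change Z2L _ = 0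
    simp [Z2L, hYb]
  · change Z3L _ = 0
    simp [Z3L, hY]
  · change Z4L _ = 0
    simp [Z4L, hY]
  · exact Z5L_nullWeyl τ p q

theorem part_nullWeyl {τ : ℝ} (hτ : τ ^ 2 = 1) (p q : ℝ) {J : PartIdx} (hJ : J ≠ weyl) :
    part J (nullWeyl τ p q) = 0 := by
  rw [← partL_apply, partL_nullWeyl hτ p q hJ]

theorem part_weyl_nullWeyl {τ : ℝ} (hτ : τ ^ 2 = 1) (p q : ℝ) :
    part weyl (nullWeyl τ p q) = nullWeyl τ p q := by
  have h2 : W2L (nullWeyl τ p q) = 0 := partL_nullWeyl hτ p q (J := .inl 1) (by decide)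
  have h3 : W3L (nullWeyl τ p q) = 0 := partL_nullWeyl hτ p q (J := .inl 2) (by decide)
  have h4 : W4L (nullWeyl τ p q) = 0 := partL_nullWeyl hτ p q (J := .inl 3) (by decide)
  have h5 : W5L (nullWeyl τ p q) = 0 := partL_nullWeyl hτ p q (J := .inl 4) (by decide)
  have h6 : W6L (nullWeyl τ p q) = 0 := partL_nullWeyl hτ p q (J := .inl 5) (by decide)
  change W1 _ = _
  rw [← W1L_apply]
  simp [W1L, h2, h3, h4, h5, h6, WofL_nullWeyl]

/-! ### Simplicity of the Weyl part -/

/-- The value of a curvature tensor on four vectors. -/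
def evalCurv (S : Curv) (u v w z : Fin 4 → ℝ) : ℝ :=
  ∑ a, u a * ∑ b, v b * ∑ c, w c * ∑ d, z d * S a b c d

/-- Moves the Lorentz matrix onto the vector arguments, so that eigenvalue equations become
equations between components in the null frame. -/
theorem evalCurv_act (Λ : Matrix (Fin 4) (Fin 4) ℝ) (S : Curv) (u v w z : Fin 4 → ℝ) :
    evalCurv (act Λ S) u v w z =
      evalCurv S (Matrix.vecMul u Λ) (Matrix.vecMul v Λ) (Matrix.vecMul w Λ)
        (Matrix.vecMul z Λ) := by
  have h : ∀ (u : Fin 4 → ℝ) (g : Fin 4 → ℝ),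
      ∑ a, Matrix.vecMul u Λ a * g a = ∑ a, u a * ∑ a', Λ a a' * g a' := by
    intro u g
    simp only [Matrix.vecMul, dotProduct, Finset.sum_mul, Finset.mul_sum]
    rw [Finset.sum_comm]
    simp only [mul_assoc]
  simp only [evalCurv, act, h]
  have h4 : ∀ a b c d, ∑ a', ∑ b', ∑ c', ∑ d', Λ a a' * Λ b b' * Λ c c' * Λ d d' * S a' b' c' d'
      = ∑ a', Λ a a' * ∑ b', Λ b b' * ∑ c', Λ c c' * ∑ d', Λ d d' * S a' b' c' d' := by
    intro a b c d
    simp only [Finset.mul_sum, mul_assoc]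
  simp only [h4]
  refine Finset.sum_congr rfl fun a _ => ?_
  congr 1
  have key3 : ∀ (x z : Fin 4 → ℝ) (G : Fin 4 → Fin 4 → ℝ),
      ∑ d, z d * ∑ a', x a' * G a' d = ∑ a', x a' * ∑ d, z d * G a' d := by
    intro x z G
    simp only [Finset.mul_sum]
    rw [Finset.sum_comm]
    simp only [mul_left_comm]
  have key2 : ∀ (x w z : Fin 4 → ℝ) (G : Fin 4 → Fin 4 → Fin 4 → ℝ),
      ∑ c, w c * ∑ d, z d * ∑ a', x a' * G a' c d =
      ∑ a', x a' * ∑ c, w c * ∑ d, z d * G a' c d := by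
    intro x w z G
    simp only [key3 x z]
    rw [key3 x w]
  have key : ∀ (x v w z : Fin 4 → ℝ) (G : Fin 4 → Fin 4 → Fin 4 → Fin 4 → ℝ),
      ∑ b, v b * ∑ c, w c * ∑ d, z d * ∑ a', x a' * G a' b c d =
      ∑ a', x a' * ∑ b, v b * ∑ c, w c * ∑ d, z d * G a' b c d := by
    intro x v w z G
    simp only [key2 x w z]
    rw [key3 x v]
  rw [key]
  refine Finset.sum_congr rfl fun a' _ => ?_
  congr 1
  refine Finset.sum_congr rfl fun b _ => ?_
  rw [key2]
  congr 1
  refine Finset.sum_congr rfl fun b' _ => ?_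
  congr 1
  refine Finset.sum_congr rfl fun c _ => ?_
  rw [key3]

theorem evalCurv_smul (r : ℝ) (S : Curv) (u v w z : Fin 4 → ℝ) :
    evalCurv (r • S) u v w z = r * evalCurv S u v w z := by
  simp only [evalCurv, Pi.smul_apply, smul_eq_mul, Finset.mul_sum, mul_left_comm r]

theorem evalCurv_swap {S : Curv} (hS : IsTwoForm S) (u v w z : Fin 4 → ℝ) :
    evalCurv S u v w z = -evalCurv S u v z w := by
  simp only [evalCurv, Finset.mul_sum, ← Finset.sum_neg_distrib]
  refine Finset.sum_congr rfl fun a _ => Finset.sum_congr rfl fun b _ => ?_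
  rw [Finset.sum_comm]
  refine Finset.sum_congr rfl fun c _ => Finset.sum_congr rfl fun d _ => ?_
  rw [hS a b d c]; ring

theorem evalCurv_linear (S : Curv) (r : ℝ) (u u' v w z : Fin 4 → ℝ) :
    (evalCurv S (u + u') v w z = evalCurv S u v w z + evalCurv S u' v w z ∧
    evalCurv S v (u + u') w z = evalCurv S v u w z + evalCurv S v u' w z ∧
    evalCurv S v w (u + u') z = evalCurv S v w u z + evalCurv S v w u' z ∧
    evalCurv S v w z (u + u') = evalCurv S v w z u + evalCurv S v w z u') ∧
    evalCurv S (r • u) v w z = r * evalCurv S u v w z ∧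
    evalCurv S v (r • u) w z = r * evalCurv S v u w z ∧
    evalCurv S v w (r • u) z = r * evalCurv S v w u z ∧
    evalCurv S v w z (r • u) = r * evalCurv S v w z u := by
  simp only [evalCurv, Pi.add_apply, add_mul, mul_add, Finset.sum_add_distrib, Pi.smul_apply,
    smul_eq_mul, Finset.mul_sum, mul_assoc, mul_left_comm _ r, and_self]

/-- The null frame `∂_t + ∂_z, ∂_x, ∂_y, ∂_t - ∂_z`. -/
def nullFrame : Fin 4 → Fin 4 → ℝ := ![![1, 0, 0, 1], ![0, 1, 0, 0], ![0, 0, 1, 0], ![1, 0, 0, -1]]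

theorem eq_zero_of_nullFrame {g : Fin 4 → ℝ} (h : ∀ i, ∑ a, nullFrame i a * g a = 0) (a : Fin 4) :
    g a = 0 := by
  have h0 := h 0
  have h1 := h 1
  have h2 := h 2
  have h3 := h 3
  simp [Fin.sum_univ_four, nullFrame] at h0 h1 h2 h3
  fin_cases a <;> simp <;> linarith

theorem curv_eq_zero_of_nullFrame {S : Curv} (h : ∀ i j k l,
    evalCurv S (nullFrame i) (nullFrame j) (nullFrame k) (nullFrame l) = 0) : S = 0 := by
  ext a b c d
  refine eq_zero_of_nullFrame (g := S a b c) (fun l => ?_) d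
  refine eq_zero_of_nullFrame (g := fun c => ∑ d, nullFrame l d * S a b c d) (fun k => ?_) c
  refine eq_zero_of_nullFrame
    (g := fun b => ∑ c, nullFrame k c * ∑ d, nullFrame l d * S a b c d) (fun j => ?_) b
  exact eq_zero_of_nullFrame (g := fun a => ∑ b, nullFrame j b *
    ∑ c, nullFrame k c * ∑ d, nullFrame l d * S a b c d) (fun i => h i j k l) a

/-- The boost in the `z` direction with rapidity `log 2`. -/
def boost : Matrix (Fin 4) (Fin 4) ℝ :=
  !![5/4, 0, 0, 3/4; 0, 1, 0, 0; 0, 0, 1, 0; 3/4, 0, 0, 5/4]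

/-- The rotation by a right angle about the `z` axis. -/
def quarterTurn : Matrix (Fin 4) (Fin 4) ℝ :=
  !![1, 0, 0, 0; 0, 0, 1, 0; 0, -1, 0, 0; 0, 0, 0, 1]

/-- A null rotation that fixes `∂_t - ∂_z`. -/
def nullRotation : Matrix (Fin 4) (Fin 4) ℝ :=
  !![3/2, 1, 0, -1/2; 1, 1, 0, -1; 0, 0, 1, 0; 1/2, 1, 0, 1/2]

theorem isLorentz_boost : IsLorentz boost := by
  unfold IsLorentz
  ext i j
  rw [Matrix.mul_apply]
  simp only [Matrix.mul_diagonal, Matrix.diagonal_apply, Matrix.transpose_apply]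
  fin_cases i <;> fin_cases j <;> simp [boost, Fin.sum_univ_four, eta] <;> norm_num

theorem isLorentz_quarterTurn : IsLorentz quarterTurn := by
  unfold IsLorentz
  ext i j
  rw [Matrix.mul_apply]
  simp only [Matrix.mul_diagonal, Matrix.diagonal_apply, Matrix.transpose_apply]
  fin_cases i <;> fin_cases j <;> simp [quarterTurn, Fin.sum_univ_four, eta]

theorem isLorentz_nullRotation : IsLorentz nullRotation := by
  unfold IsLorentz
  ext i j
  rw [Matrix.mul_apply]
  simp only [Matrix.mul_diagonal, Matrix.diagonal_apply, Matrix.transpose_apply]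
  fin_cases i <;> fin_cases j <;> simp [nullRotation, Fin.sum_univ_four, eta] <;> norm_num

/-- The action of a change of frame on 2-forms. -/
def act2 (Λ : Matrix (Fin 4) (Fin 4) ℝ) (α : Form2) : Form2 := fun a b =>
  ∑ a', ∑ b', Λ a a' * Λ b b' * α a' b'

theorem act_nullWeyl (Λ : Matrix (Fin 4) (Fin 4) ℝ) (a b c d : Fin 4) :
    act Λ (nullWeyl 1 1 0) a b c d = act2 Λ (nullX 1) a b * act2 Λ (nullX 1) c d
      - act2 Λ (nullY 1) a b * act2 Λ (nullY 1) c d := by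
  simp only [act, act2, nullWeyl, Finset.sum_mul]
  simp only [Finset.mul_sum, ← Finset.sum_sub_distrib]
  repeat refine Finset.sum_congr rfl fun _ _ => ?_
  ring

theorem act_nullWeyl_of_act2 {Λ : Matrix (Fin 4) (Fin 4) ℝ} {r : ℝ}
    (hX : act2 Λ (nullX 1) = r • nullX 1) (hY : act2 Λ (nullY 1) = r • nullY 1) :
    act Λ (nullWeyl 1 1 0) = r ^ 2 • nullWeyl 1 1 0 := by
  ext a b c d
  rw [act_nullWeyl, hX, hY]
  simp only [Pi.smul_apply, smul_eq_mul, nullWeyl]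
  ring

theorem act_boost_nullWeyl : act boost (nullWeyl 1 1 0) = (4 : ℝ) • nullWeyl 1 1 0 := by
  rw [act_nullWeyl_of_act2 (r := 2)]
  · norm_num
  all_goals
    ext a b
    simp only [act2, Pi.smul_apply, smul_eq_mul, nullX_eq, nullY_eq]
    fin_cases a <;> fin_cases b <;> simp [Fin.sum_univ_four, boost] <;> norm_num

theorem act_nullRotation_nullWeyl :
    act nullRotation (nullWeyl 1 1 0) = (1 : ℝ) • nullWeyl 1 1 0 := by
  rw [act_nullWeyl_of_act2 (r := 1)]
  · norm_num
  all_goals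
    ext a b
    simp only [act2, Pi.smul_apply, smul_eq_mul, nullX_eq, nullY_eq]
    fin_cases a <;> fin_cases b <;> simp [Fin.sum_univ_four, nullRotation] <;> norm_num

theorem act_quarterTurn_nullWeyl :
    act quarterTurn (nullWeyl 1 1 0) = (-1 : ℝ) • nullWeyl 1 1 0 := by
  have hX : act2 quarterTurn (nullX 1) = -nullY 1 := by
    ext a b
    simp only [act2, Pi.neg_apply, nullX_eq, nullY_eq]
    fin_cases a <;> fin_cases b <;> simp [Fin.sum_univ_four, quarterTurn]
  have hY : act2 quarterTurn (nullY 1) = nullX 1 := by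
    ext a b
    simp only [act2, nullX_eq, nullY_eq]
    fin_cases a <;> fin_cases b <;> simp [Fin.sum_univ_four, quarterTurn]
  ext a b c d
  rw [act_nullWeyl, hX, hY]
  simp only [Pi.neg_apply, Pi.smul_apply, smul_eq_mul, nullWeyl]
  ring

theorem nullFrame_vecMul :
    (∀ i, Matrix.vecMul (nullFrame i) boost = (![2, 1, 1, 1 / 2] i : ℝ) • nullFrame i) ∧
    Matrix.vecMul (nullFrame 0) quarterTurn = nullFrame 0 ∧
    Matrix.vecMul (nullFrame 1) quarterTurn = nullFrame 2 ∧
    Matrix.vecMul (nullFrame 2) quarterTurn = (-1 : ℝ) • nullFrame 1 ∧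
    Matrix.vecMul (nullFrame 3) quarterTurn = nullFrame 3 ∧
    Matrix.vecMul (nullFrame 0) nullRotation =
      nullFrame 0 + ((2 : ℝ) • nullFrame 1 + nullFrame 3) ∧
    Matrix.vecMul (nullFrame 1) nullRotation = nullFrame 1 + nullFrame 3 ∧
    Matrix.vecMul (nullFrame 2) nullRotation = nullFrame 2 := by
  refine ⟨fun i => ?_, ?_, ?_, ?_, ?_, ?_, ?_, ?_⟩
  · ext b
    fin_cases i <;> fin_cases b <;>
      simp [Matrix.vecMul, dotProduct, nullFrame, boost, Fin.sum_univ_four] <;> norm_num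
  all_goals
    ext b
    fin_cases b <;>
      simp [Matrix.vecMul, dotProduct, nullFrame, quarterTurn, nullRotation, Fin.sum_univ_four] <;>
      norm_num

/-- Raising the index of `dt - dz` gives `∂_t + ∂_z`, so pairing with the opposite type N tensors
(`τ = -1`) reads off components of `S` of boost weight 2. -/
theorem pairing_nullWeyl_eq_evalCurv {S : Curv} (hS : IsTwoForm S) (p q : ℝ) :
    pairing (nullWeyl (-1) p q) S =
      p * (evalCurv S (nullFrame 0) (nullFrame 1) (nullFrame 0) (nullFrame 1)
        - evalCurv S (nullFrame 1) (nullFrame 0) (nullFrame 0) (nullFrame 1)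
        - evalCurv S (nullFrame 0) (nullFrame 2) (nullFrame 0) (nullFrame 2)
        + evalCurv S (nullFrame 2) (nullFrame 0) (nullFrame 0) (nullFrame 2))
      + q * (evalCurv S (nullFrame 0) (nullFrame 1) (nullFrame 0) (nullFrame 2)
        - evalCurv S (nullFrame 1) (nullFrame 0) (nullFrame 0) (nullFrame 2)
        + evalCurv S (nullFrame 0) (nullFrame 2) (nullFrame 0) (nullFrame 1)
        - evalCurv S (nullFrame 2) (nullFrame 0) (nullFrame 0) (nullFrame 1)) := by
  have h : ∀ a b, S a b 1 0 = -S a b 0 1 ∧ S a b 2 0 = -S a b 0 2 ∧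
      S a b 3 1 = -S a b 1 3 ∧ S a b 3 2 = -S a b 2 3 :=
    fun a b => ⟨hS _ _ _ _, hS _ _ _ _, hS _ _ _ _, hS _ _ _ _⟩
  rw [pairing_nullWeyl]
  simp [Fin.sum_univ_four, nullX_eq, nullY_eq, eta, evalCurv, nullFrame, h]
  ring

/-- The frame vectors have boost weights 1, 0, 0, -1, and the eigenvalue `4 = 2²` leaves only
components of total weight 2: ten of them, up to antisymmetry in the last pair. The quarter turn
kills `T 0 0 0 3` and `T 0 0 1 2` and identifies the other eight in pairs. Invariance under the null
rotation makes these antisymmetric in the first pair. Two numbers remain, and the pairings with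
`nullWeyl (-1)` are nonzero multiples of them. -/
theorem eq_zero_of_highest_weight {S : Curv} (hS : IsTwoForm S)
    (hB : act boost S = (4 : ℝ) • S) (hR : act quarterTurn S = (-1 : ℝ) • S)
    (hN : act nullRotation S = (1 : ℝ) • S)
    (hp : ∀ p q, pairing (nullWeyl (-1) p q) S = 0) : S = 0 := by
  obtain ⟨vB, vR0, vR1, vR2, vR3, vN0, vN1, vN2⟩ := nullFrame_vecMul
  have lin := evalCurv_linear S
  set T : Fin 4 → Fin 4 → Fin 4 → Fin 4 → ℝ := fun i j k l =>
    evalCurv S (nullFrame i) (nullFrame j) (nullFrame k) (nullFrame l) with hT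
  have eT : ∀ i j k l, evalCurv S (nullFrame i) (nullFrame j) (nullFrame k) (nullFrame l) =
    T i j k l := fun _ _ _ _ => rfl
  have anti : ∀ i j k l, T i j k l = -T i j l k := fun i j k l => evalCurv_swap hS _ _ _ _
  have add₁ := fun u u' v w z => (lin 1 u u' v w z).1.1
  have add₂ := fun u u' v w z => (lin 1 u u' v w z).1.2.1
  have add₃ := fun u u' v w z => (lin 1 u u' v w z).1.2.2.1
  have add₄ := fun u u' v w z => (lin 1 u u' v w z).1.2.2.2
  have smul₁ := fun r u v w z => (lin r u u v w z).2.1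
  have smul₂ := fun r u v w z => (lin r u u v w z).2.2.1
  have smul₃ := fun r u v w z => (lin r u u v w z).2.2.2.1
  have smul₄ := fun r u v w z => (lin r u u v w z).2.2.2.2
  have weight : ∀ i j k l, (![2, 1, 1, 1 / 2] i : ℝ) * ![2, 1, 1, 1 / 2] j * ![2, 1, 1, 1 / 2] k *
      ![2, 1, 1, 1 / 2] l ≠ 4 → T i j k l = 0 := by
    intro i j k l h
    have e := evalCurv_act boost S (nullFrame i) (nullFrame j) (nullFrame k) (nullFrame l)
    rw [hB, evalCurv_smul] at e
    simp only [vB, smul₁, smul₂, smul₃, smul₄, eT] at e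
    have : ((![2, 1, 1, 1 / 2] i : ℝ) * ![2, 1, 1, 1 / 2] j * ![2, 1, 1, 1 / 2] k *
      ![2, 1, 1, 1 / 2] l - 4) * T i j k l = 0 := by linarith
    exact (mul_eq_zero.mp this).resolve_left (sub_ne_zero.mpr h)
  have rot := fun i j k l =>
    evalCurv_act quarterTurn S (nullFrame i) (nullFrame j) (nullFrame k) (nullFrame l)
  simp only [hR, evalCurv_smul, eT] at rot
  have r0003 : T 0 0 0 3 = 0 := by
    have := rot 0 0 0 3
    simp only [vR0, vR3, eT] at this; linarith
  have r0012 : T 0 0 1 2 = 0 := by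
    have := rot 0 0 1 2
    simp only [vR0, vR1, vR2, smul₄, eT] at this; linarith [anti 0 0 1 2]
  have ra := rot 0 1 0 1
  have rb := rot 0 1 0 2
  have rc := rot 1 0 0 1
  have rd := rot 1 0 0 2
  simp only [vR0, vR1, vR2, smul₄, eT] at ra rb rc rd
  -- For `i = 1, 2` the component `T 0 0 0 i` has weight 3 and vanishes, so the weight-2 terms in
  -- the expansion of its rotated version must sum to zero.
  have null := fun i => evalCurv_act nullRotation S (nullFrame 0) (nullFrame 0) (nullFrame 0)
    (nullFrame i)
  simp only [hN, evalCurv_smul, eT] at null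
  have n1 := null 1
  have n2 := null 2
  -- Exponents of 2 replace the real eigenvalues, so that the weight condition can be discharged by
  -- `decide`.
  have w : ∀ i j k l, ![(1 : ℤ), 0, 0, -1] i + ![(1 : ℤ), 0, 0, -1] j + ![(1 : ℤ), 0, 0, -1] k +
      ![(1 : ℤ), 0, 0, -1] l ≠ 2 → T i j k l = 0 := by
    intro i j k l h
    refine weight i j k l fun h' => h ?_
    have hz : ∀ i : Fin 4, (![2, 1, 1, 1 / 2] i : ℝ) = 2 ^ ![(1 : ℤ), 0, 0, -1] i := by
      intro i; fin_cases i <;> simp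
    rw [hz, hz, hz, hz, ← zpow_add₀ two_ne_zero, ← zpow_add₀ two_ne_zero,
      ← zpow_add₀ two_ne_zero, show (4 : ℝ) = 2 ^ (2 : ℤ) by norm_num] at h'
    exact zpow_right_injective₀ two_pos (by norm_num) h'
  have r0011 : T 0 0 1 1 = 0 := by linarith [anti 0 0 1 1]
  simp only [vN0, vN1, vN2, add₁, add₂, add₃, add₄, smul₁, smul₂, smul₃, eT] at n1 n2
  simp (disch := decide) only [w] at n1 n2
  have hp1 := hp 1 0
  have hp2 := hp 0 1
  rw [pairing_nullWeyl_eq_evalCurv hS] at hp1 hp2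
  simp only [eT] at hp1 hp2
  have s0101 : T 0 1 0 1 = 0 := by linarith
  have s0102 : T 0 1 0 2 = 0 := by linarith
  have s1001 : T 1 0 0 1 = 0 := by linarith
  have s1002 : T 1 0 0 2 = 0 := by linarith
  have s0201 : T 0 2 0 1 = 0 := by linarith
  have s0202 : T 0 2 0 2 = 0 := by linarith
  have s2001 : T 2 0 0 1 = 0 := by linarith
  have s2002 : T 2 0 0 2 = 0 := by linarith
  have diag : ∀ i j k, T i j k k = 0 := fun i j k => by linarith [anti i j k k]
  refine curv_eq_zero_of_nullFrame fun i j k l => ?_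
  rw [eT]
  by_cases h : ![(1 : ℤ), 0, 0, -1] i + ![(1 : ℤ), 0, 0, -1] j + ![(1 : ℤ), 0, 0, -1] k +
      ![(1 : ℤ), 0, 0, -1] l = 2
  swap
  · exact w i j k l h
  wlog hkl : k ≤ l generalizing k l
  · rw [anti, neg_eq_zero]
    exact this l k (by linarith) (le_of_not_ge hkl)
  have enum : ∀ i j k l : Fin 4, k ≤ l → ![(1 : ℤ), 0, 0, -1] i + ![(1 : ℤ), 0, 0, -1] j +
      ![(1 : ℤ), 0, 0, -1] k + ![(1 : ℤ), 0, 0, -1] l = 2 →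
      k = l ∨ (i, j, k, l) ∈ ({(0, 0, 0, 3), (0, 0, 1, 2), (0, 1, 0, 1), (0, 1, 0, 2),
        (1, 0, 0, 1), (1, 0, 0, 2), (0, 2, 0, 1), (0, 2, 0, 2), (2, 0, 0, 1),
        (2, 0, 0, 2)} : Finset (Fin 4 × Fin 4 × Fin 4 × Fin 4)) := by decide
  rcases enum i j k l hkl h with rfl | h
  · exact diag i j k
  · have hall : ∀ t ∈ ({(0, 0, 0, 3), (0, 0, 1, 2), (0, 1, 0, 1), (0, 1, 0, 2),
        (1, 0, 0, 1), (1, 0, 0, 2), (0, 2, 0, 1), (0, 2, 0, 2), (2, 0, 0, 1),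
        (2, 0, 0, 2)} : Finset (Fin 4 × Fin 4 × Fin 4 × Fin 4)),
        T t.1 t.2.1 t.2.2.1 t.2.2.2 = 0 := by
      simp only [Finset.forall_mem_insert, Finset.mem_singleton, forall_eq]
      exact ⟨r0003, r0012, s0101, s0102, s1001, s1002, s0201, s0202, s2001, s2002⟩
    exact hall _ h

/-- The tensors whose entries are 2-forms. -/
def twoForms : Submodule ℝ Curv where
  carrier := {R | IsTwoForm R}
  add_mem' {R S} hR hS a b c d := by
    simp only [Pi.add_apply]; rw [hR a b c d, hS a b c d]; ring
  zero_mem' a b c d := by simp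
  smul_mem' r R hR a b c d := by
    simp only [Pi.smul_apply, smul_eq_mul]; rw [hR a b c d]; ring

theorem starL_mem_twoForms (R : Curv) : starL R ∈ twoForms :=
  fun _ _ _ _ => star2_antisymm _ _ _

theorem antis_antisymm (ξ : Fin 4 → Form1) (c d : Fin 4) : antis ξ c d = -antis ξ d c := by
  simp only [antis, Finset.sum_apply, ← Finset.sum_neg_distrib]
  exact Finset.sum_congr rfl fun _ _ => wedge11_antisymm _ _ _ _

theorem thetaAlt_mem_twoForms (ξ : Fin 4 → Form1) : thetaAlt ξ ∈ twoForms := by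
  intro a b c d; simp only [thetaAlt, wedge11, Pi.smul_apply, Pi.sub_apply, smul_eq_mul]; ring

theorem thetaSym_mem_twoForms (ξ : Fin 4 → Form1) : thetaSym ξ ∈ twoForms := by
  intro a b c d; simp only [thetaSym, wedge11, Pi.smul_apply, Pi.add_apply, smul_eq_mul]; ring

theorem metricL_antis_mem_twoForms (ξ : Fin 4 → Form1) : metricL (antis ξ) ∈ twoForms := by
  intro a b c d
  change metric a b * _ = -(metric a b * _)
  rw [antis_antisymm]; ring

theorem Zof_mem_twoForms {R : Curv} (hR : IsTwoForm R) : Zof R ∈ twoForms := by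
  intro a b c d
  simp only [Zof, Pi.smul_apply, Pi.add_apply, smul_eq_mul]
  rw [hR a b c d, hR b a c d]; ring

theorem Z5_mem_twoForms {R : Curv} (hR : IsTwoForm R) : Z5 R ∈ twoForms := by
  intro a b c d
  simp only [Z5, Pi.smul_apply, Finset.sum_apply, smul_eq_mul, Finset.mul_sum,
    ← Finset.sum_neg_distrib]
  refine Finset.sum_congr rfl fun e _ => ?_
  rw [Zof_mem_twoForms hR e e c d]; ring

theorem Z2_mem_twoForms (R : Curv) : Z2 R ∈ twoForms :=
  twoForms.smul_mem (-(1 / 2) : ℝ) (starL_mem_twoForms (thetaSym (Phibar R)))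

theorem isTwoForm_part {J : PartIdx} (hJ : J ≠ weyl) {R : Curv} (hR : IsTwoForm R) :
    IsTwoForm (part J R) := by
  change part J R ∈ twoForms
  have z3 : Z3 R ∈ twoForms := by
    rw [← Z3L_apply]
    exact twoForms.smul_mem _ (twoForms.sub_mem (twoForms.smul_mem _ (thetaSym_mem_twoForms _))
      (twoForms.smul_mem _ (metricL_antis_mem_twoForms _)))
  have z4 : Z4 R ∈ twoForms := twoForms.smul_mem _ (thetaSym_mem_twoForms _)
  rcases J with J | J <;> fin_cases J
  · exact absurd rfl hJ
  · change W2 R ∈ _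
    rw [← W2L_apply]
    exact twoForms.neg_mem (starL_mem_twoForms _)
  · change W3 R ∈ _
    rw [← W3L_apply]
    exact twoForms.smul_mem _ (starL_mem_twoForms _)
  · exact twoForms.neg_mem (thetaAlt_mem_twoForms (Psi R))
  · exact twoForms.smul_mem _ (thetaAlt_mem_twoForms _)
  · change W6 R ∈ _
    rw [← W6L_apply]
    exact twoForms.smul_mem _ (thetaAlt_mem_twoForms _)
  · exact twoForms.sub_mem (Zof_mem_twoForms hR) (twoForms.add_mem (twoForms.add_mem
      (twoForms.add_mem (Z2_mem_twoForms R) z3) z4) (Z5_mem_twoForms hR))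
  · exact Z2_mem_twoForms R
  · exact z3
  · exact z4
  · exact Z5_mem_twoForms hR

/-- The generators already form a linear subspace, the image of `twoForms` under `partL J`. -/
theorem mem_partSpace {J : PartIdx} {S : Curv} (hS : S ∈ partSpace J) :
    ∃ R, IsTwoForm R ∧ S = part J R := by
  have h : partSpace J ≤ twoForms.map (partL J) := by
    refine Submodule.span_le.mpr ?_
    rintro _ ⟨R, hR, rfl⟩
    exact ⟨R, hR, partL_apply J R⟩
  obtain ⟨R, hR, rfl⟩ := h hS
  exact ⟨R, hR, partL_apply J R⟩

theorem isSimplePart_weyl : IsSimplePart weyl := by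
  rintro J hJ ⟨f, hf⟩
  have hmem : nullWeyl 1 1 0 ∈ partSpace weyl := Submodule.subset_span
    ⟨_, nullWeyl_isTwoForm 1 1 0, (part_weyl_nullWeyl (by norm_num) 1 0).symm⟩
  set x : partSpace weyl := ⟨nullWeyl 1 1 0, hmem⟩ with hx
  have heq : ∀ (Λ : Matrix (Fin 4) (Fin 4) ℝ) (r : ℝ), IsLorentz Λ →
      act Λ (nullWeyl 1 1 0) = r • nullWeyl 1 1 0 → act Λ (f x : Curv) = r • (f x : Curv) := by
    intro Λ r hΛ h
    -- Equivariance is a statement about pairs with `y = act Λ x`; on an eigenvector the multiple `r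
    -- • x` serves as `y`, so no general invariance of `partSpace` is needed.
    have := hf Λ hΛ x (r • x) h.symm
    rw [map_smul] at this
    exact this.symm
  obtain ⟨R, hR, hfx⟩ := mem_partSpace (f x).2
  have h0 : (f x : Curv) = 0 := by
    refine eq_zero_of_highest_weight ?_ (heq _ _ isLorentz_boost act_boost_nullWeyl)
      (heq _ _ isLorentz_quarterTurn act_quarterTurn_nullWeyl)
      (heq _ _ isLorentz_nullRotation act_nullRotation_nullWeyl) fun p q => ?_
    · rw [hfx]; exact isTwoForm_part hJ hR
    · rw [hfx]; exact pairing_nullWeyl_part (by norm_num) p q hJ R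
  have h1 : x = 0 := by
    rw [← f.map_eq_zero_iff]; exact Subtype.ext h0
  have h2 : nullWeyl 1 1 0 0 1 0 1 = 0 := by
    have := congrArg (Subtype.val) h1
    rw [hx] at this
    change nullWeyl 1 1 0 = 0 at this
    rw [this]; rfl
  simp [nullWeyl, nullX_eq, nullY_eq] at h2

/-! ### Differentiation under the integral sign and integrals of derivatives. -/

open MeasureTheory Set Filter Topology in
/-- Differentiation under the integral sign for a compactly supported family of functions that is
continuously differentiable near the base parameter. -/
theorem hasDerivAt_integral_of_contDiffAt {f : ℝ × Pt → ℝ} {K : Set Pt} (hK : IsCompact K)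
    (hf0 : ∀ ε, ∀ x ∉ K, f (ε, x) = 0) (hf : ∀ x, ContDiffAt ℝ 1 f (0, x)) (h0 : ∀ x, f (0, x) = 0)
    {g : Pt → ℝ} (hg : ∀ x, HasDerivAt (fun ε => f (ε, x)) (g x) 0) (hg0 : ∫ x, g x = 0) :
    HasDerivAt (fun ε => ∫ x, f (ε, x)) 0 0 := by
  have hUopen : IsOpen {p : ℝ × Pt | ContDiffAt ℝ 1 f p} := by
    rw [isOpen_iff_mem_nhds]
    intro p hp
    exact ContDiffAt.eventually hp (by simp)
  -- Smoothness is known only at `ε = 0`, since a varied coframe may degenerate for larger `ε`.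
  -- Compactness of `K` gives one interval of `ε` that works on a neighbourhood of `K`.
  obtain ⟨u, v, hu, hv, h0u, hKv, huv⟩ := generalized_tube_lemma (s := {(0 : ℝ)})
    isCompact_singleton hK hUopen (by rintro ⟨ε, x⟩ ⟨rfl, -⟩; exact hf x)
  obtain ⟨r, hr, hru⟩ := Metric.isOpen_iff.mp hu 0 (h0u rfl)
  have hsub : Metric.closedBall (0 : ℝ) (r / 2) ⊆ u :=
    (Metric.closedBall_subset_ball (by linarith)).trans hru
  have hU : ∀ ε ∈ Metric.closedBall (0 : ℝ) (r / 2), ∀ x ∈ v, ContDiffAt ℝ 1 f (ε, x) :=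
    fun ε hε x hx => huv ⟨hsub hε, hx⟩
  have hcont : ∀ (h : Pt → ℝ), (∀ x ∈ v, ContinuousAt h x) → (∀ x ∉ K, h x = 0) → Continuous h := by
    intro h hv' hK'
    rw [continuous_iff_continuousAt]
    intro x
    by_cases hx : x ∈ K
    · exact hv' x (hKv hx)
    · refine ContinuousAt.congr (f := fun _ => (0 : ℝ)) continuousAt_const ?_
      filter_upwards [hK.isClosed.isOpen_compl.mem_nhds hx] with y hy
      exact (hK' y hy).symm
  have hderiv : ∀ ε ∈ Metric.closedBall (0 : ℝ) (r / 2), ∀ x ∈ v,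
      HasDerivAt (fun ε => f (ε, x)) (fderiv ℝ f (ε, x) (1, 0)) ε := by
    intro ε hε x hx
    have h1 := ((hU ε hε x hx).differentiableAt (by simp)).hasFDerivAt
    have h2 : HasDerivAt (fun ε : ℝ => (ε, x)) ((1 : ℝ), (0 : Pt)) ε :=
      (hasDerivAt_id ε).prodMk (hasDerivAt_const ε x)
    exact h1.comp_hasDerivAt ε h2
  have hfc : ∀ ε ∈ Metric.closedBall (0 : ℝ) (r / 2), ∀ x ∈ v,
      ContinuousAt (fun p : ℝ × Pt => fderiv ℝ f p (1, 0)) (ε, x) := by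
    intro ε hε x hx
    have h1 : ContinuousAt (fderiv ℝ f) (ε, x) :=
      ((hU ε hε x hx).fderiv_right (m := 0) (by simp)).continuousAt
    exact h1.clm_apply continuousAt_const
  obtain ⟨M, hM⟩ := ((isCompact_closedBall (0 : ℝ) (r / 2)).prod hK).exists_bound_of_continuousOn
    (f := fun p : ℝ × Pt => fderiv ℝ f p (1, 0))
    (fun p hp => (hfc p.1 hp.1 p.2 (hKv hp.2)).continuousWithinAt)
  have hdz : ∀ ε, ∀ x ∉ K, HasDerivAt (fun ε => f (ε, x)) 0 ε := by
    intro ε x hx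
    have : (fun ε => f (ε, x)) = fun _ => 0 := by ext ε; exact hf0 ε x hx
    rw [this]; exact hasDerivAt_const _ _
  have hgK : ∀ x ∉ K, g x = 0 := fun x hx => (hg x).unique (hdz 0 x hx)
  have h0mem : (0 : ℝ) ∈ Metric.closedBall (0 : ℝ) (r / 2) :=
    Metric.mem_closedBall_self (by linarith)
  have hgc : Continuous g := by
    refine hcont g (fun x hx => ?_) hgK
    have h1 : ContinuousAt (fun y : Pt => fderiv ℝ f ((0 : ℝ), y) (1, 0)) x :=
      ContinuousAt.comp (f := fun y : Pt => ((0 : ℝ), y)) (hfc 0 h0mem x hx)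
        (by fun_prop)
    refine h1.congr ?_
    filter_upwards [hv.mem_nhds hx] with y hy
    exact (hderiv 0 h0mem y hy).unique (hg y)
  have key := hasDerivAt_integral_of_dominated_loc_of_deriv_le (μ := (volume : Measure Pt))
    (F := fun ε x => f (ε, x)) (x₀ := (0 : ℝ))
    -- The partial derivative in `ε` exists everywhere, as `f` is constant in `ε` off `K`; joint
    -- differentiability may fail there for `ε ≠ 0`.
    (F' := fun ε x => deriv (fun ε => f (ε, x)) ε) (bound := K.indicator fun _ => M)
    (s := Metric.closedBall (0 : ℝ) (r / 2)) (Metric.closedBall_mem_nhds _ (by linarith))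
    ?_ ?_ ?_ ?_ ?_ ?_
  · have h1 : (fun x => deriv (fun ε => f (ε, x)) 0) = g := by ext x; exact (hg x).deriv
    have h2 := key.2
    rw [h1, hg0] at h2
    exact h2
  · filter_upwards [Metric.closedBall_mem_nhds (0 : ℝ) (show 0 < r / 2 by linarith)] with ε hε
    refine (hcont _ (fun x hx => ?_) (hf0 ε)).aestronglyMeasurable
    exact ContinuousAt.comp (f := fun y : Pt => (ε, y)) (hU ε hε x hx).continuousAt (by fun_prop)
  · simp [h0]
  · have h1 : (fun x => deriv (fun ε => f (ε, x)) 0) = g := by ext x; exact (hg x).deriv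
    rw [h1]; exact hgc.aestronglyMeasurable
  · refine Eventually.of_forall fun x ε hε => ?_
    by_cases hx : x ∈ K
    · rw [indicator_of_mem hx, (hderiv ε hε x (hKv hx)).deriv]
      exact hM (ε, x) ⟨hε, hx⟩
    · rw [indicator_of_notMem hx, (hdz ε x hx).deriv]; simp
  · exact (integrable_indicator_iff hK.measurableSet).mpr
      (integrableOn_const hK.measure_lt_top.ne)
  · refine Eventually.of_forall fun x ε hε => ?_
    by_cases hx : x ∈ K
    · exact (hderiv ε hε x (hKv hx)).differentiableAt.hasDerivAt
    · exact (hdz ε x hx).differentiableAt.hasDerivAt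

open MeasureTheory in
/-- The integral of a partial derivative of a compactly supported function vanishes. -/
theorem integral_pd_eq_zero {f : Pt → ℝ} (hf : ContDiff ℝ 1 f) (hc : HasCompactSupport f)
    (μ : Fin 4) : ∫ x, pd μ f x = 0 := by
  have hi : Integrable (fun x => pd μ f x) :=
    ((hf.continuous_fderiv (by simp)).clm_apply continuous_const).integrable_of_hasCompactSupport
      (hc.fderiv_apply ℝ _)
  have h := integral_mul_fderiv_eq_neg_fderiv_mul_of_integrable (μ := (volume : Measure Pt))
    (f := fun _ => (1 : ℝ)) (g := f) (v := Pi.single μ 1) (by simp)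
    (by simp only [one_mul]; exact hi) (by simpa using hf.continuous.integrable_of_hasCompactSupport hc)
    (by simp) (fun x _ => hf.differentiable (by simp) x)
  simpa [pd] using h

/-! ### Variations of the coframe -/

theorem contDiff_bilin {E : Type*} [NormedAddCommGroup E] [NormedSpace ℝ E] {n : ℕ∞ω}
    (B : Curv →ₗ[ℝ] Curv →ₗ[ℝ] ℝ) {F G : E → Curv} {x : E}
    (hF : ContDiffAt ℝ n F x) (hG : ContDiffAt ℝ n G x) :
    ContDiffAt ℝ n (fun y => B (F y) (G y)) x :=
  (LinearMap.toContinuousBilinearMap B).isBoundedBilinearMap.contDiff.comp_contDiffAt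
    x (hF.prodMk hG)

theorem hasDerivAt_bilin (B : Curv →ₗ[ℝ] Curv →ₗ[ℝ] ℝ) {F G : ℝ → Curv} {F' G' : Curv} {ε : ℝ}
    (hF : HasDerivAt F F' ε) (hG : HasDerivAt G G' ε) :
    HasDerivAt (fun y => B (F y) (G y)) (B (F ε) G' + B F' (G ε)) ε := by
  have h := ((LinearMap.toContinuousBilinearMap B).isBoundedBilinearMap.hasFDerivAt
    (F ε, G ε)).comp_hasDerivAt ε (hF.prodMk hG)
  exact h

theorem cartesian_eq_one (x : Pt) : Matrix.of (cartesian x) = 1 := by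
  ext i j; simp [cartesian, Matrix.one_apply]

/-- The change of the frame components of a tensor under a change of frame of the form indices. -/
def frameAct (N : Matrix (Fin 4) (Fin 4) ℝ) (R : Curv) : Curv := fun a b c d =>
  ∑ μ, ∑ ν, N c μ * N d ν * R a b μ ν

theorem frameAct_one (R : Curv) : frameAct 1 R = R := by
  ext a b c d
  simp [frameAct, Matrix.one_apply]

theorem frameCurvature_cartesian (Γ : Connection) (x : Pt) (a b c d : Fin 4) :
    frameCurvature cartesian Γ x a b c d = curvature Γ x a b c d * eta b := by
  simp only [frameCurvature, cartesian_eq_one, inv_one]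
  simp [Matrix.one_apply, metric]

/-- The coordinate curvature depends on the connection alone, so at fixed connection the coframe
enters only through the inverse matrix acting on the form indices. -/
theorem frameCurvature_eq_frameAct (θ : Coframe) (Γ : Connection) (x : Pt) :
    frameCurvature θ Γ x = frameAct ((Matrix.of (θ x))⁻¹) (frameCurvature cartesian Γ x) := by
  ext a b c d
  simp only [frameAct, frameCurvature_cartesian]
  simp only [frameCurvature, metric, mul_ite, mul_zero, Finset.sum_ite_eq', Finset.mem_univ,
    if_true]

theorem contDiff_det {E : Type*} [NormedAddCommGroup E] [NormedSpace ℝ E] {n : ℕ∞ω}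
    {M : E → Matrix (Fin 4) (Fin 4) ℝ} (hM : ∀ i j, ContDiff ℝ n fun y => M y i j) :
    ContDiff ℝ n fun y => (M y).det := by
  simp only [Matrix.det_apply]
  refine ContDiff.sum fun σ _ => ContDiff.const_smul _ ?_
  exact contDiff_prod fun i _ => hM _ _

theorem contDiffAt_inv {E : Type*} [NormedAddCommGroup E] [NormedSpace ℝ E] {n : ℕ∞ω}
    {M : E → Matrix (Fin 4) (Fin 4) ℝ} (hM : ∀ i j, ContDiff ℝ n fun y => M y i j)
    {x : E} (hx : (M x).det ≠ 0) (i j : Fin 4) : ContDiffAt ℝ n (fun y => (M y)⁻¹ i j) x := by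
  simp only [Matrix.inv_def, Matrix.smul_apply, smul_eq_mul, Ring.inverse_eq_inv',
    Matrix.adjugate_apply]
  refine ((contDiff_det hM).contDiffAt.inv hx).mul (ContDiff.contDiffAt (contDiff_det ?_))
  intro k l
  simp only [Matrix.updateRow_apply]
  split_ifs
  · exact contDiff_const
  · exact hM _ _

theorem contDiffAt_frameAct {E : Type*} [NormedAddCommGroup E] [NormedSpace ℝ E] {n : ℕ∞ω}
    {N : E → Matrix (Fin 4) (Fin 4) ℝ} {R : E → Curv} {x : E}
    (hN : ∀ i j, ContDiffAt ℝ n (fun y => N y i j) x) (hR : ContDiffAt ℝ n R x) :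
    ContDiffAt ℝ n (fun y => frameAct (N y) (R y)) x := by
  rw [contDiffAt_pi]; intro a
  rw [contDiffAt_pi]; intro b
  rw [contDiffAt_pi]; intro c
  rw [contDiffAt_pi]; intro d
  unfold frameAct
  refine ContDiffAt.sum fun μ _ => ContDiffAt.sum fun ν _ => ((hN _ _).mul (hN _ _)).mul ?_
  have h1 := contDiffAt_pi.mp hR a
  have h2 := contDiffAt_pi.mp h1 b
  have h3 := contDiffAt_pi.mp h2 μ
  exact contDiffAt_pi.mp h3 ν

/-- The derivative of the inverse at the identity. -/
theorem hasDerivAt_inv_one_add_smul (A : Matrix (Fin 4) (Fin 4) ℝ) (i j : Fin 4) :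
    HasDerivAt (fun ε : ℝ => (1 + ε • A)⁻¹ i j) (-A i j) 0 := by
  have hM : ∀ i j, ContDiff ℝ 1 fun ε : ℝ => (1 + ε • A) i j := by
    intro i j
    simp only [Matrix.add_apply, Matrix.smul_apply, smul_eq_mul]
    fun_prop
  have hdet : Continuous fun ε : ℝ => (1 + ε • A).det := (contDiff_det hM).continuous
  have hne : ∀ᶠ ε in nhds (0 : ℝ), (1 + ε • A).det ≠ 0 :=
    hdet.continuousAt.eventually_ne (by simp)
  have hd : ∀ i j, DifferentiableAt ℝ (fun ε : ℝ => (1 + ε • A)⁻¹ i j) 0 := fun i j =>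
    (contDiffAt_inv hM (by simp) i j).differentiableAt (by simp)
  -- The inverse `N` satisfies `N = 1 - ε N A`; because of the factor `ε`, differentiability of `N`
  -- and its value at 0 determine the derivative.
  have hprod : HasDerivAt (fun ε : ℝ => (1 : Matrix (Fin 4) (Fin 4) ℝ) i j
      - ε * ∑ k, (1 + ε • A)⁻¹ i k * A k j) (-A i j) 0 := by
    have h1 : DifferentiableAt ℝ (fun ε : ℝ => ∑ k, (1 + ε • A)⁻¹ i k * A k j) 0 :=
      DifferentiableAt.fun_sum fun k _ => (hd i k).mul_const _
    have h2 := ((hasDerivAt_id (0 : ℝ)).mul h1.hasDerivAt).const_sub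
      ((1 : Matrix (Fin 4) (Fin 4) ℝ) i j)
    refine h2.congr_deriv ?_
    simp [Matrix.one_apply]
  refine hprod.congr_of_eventuallyEq ?_
  filter_upwards [hne] with ε hε
  have h1 : (1 + ε • A)⁻¹ * (1 + ε • A) = 1 :=
    Matrix.nonsing_inv_mul _ (isUnit_iff_ne_zero.mpr hε)
  rw [mul_add, mul_one, Matrix.mul_smul] at h1
  have h2 := congrFun (congrFun h1 i) j
  rw [Matrix.add_apply, Matrix.smul_apply, Matrix.mul_apply, smul_eq_mul] at h2
  linarith

theorem hasDerivAt_det_one_add_smul (A : Matrix (Fin 4) (Fin 4) ℝ) :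
    HasDerivAt (fun ε : ℝ => (1 + ε • A).det) A.trace 0 := by
  have h := Matrix.derivative_det_one_add_X_smul A
  have h2 : ∀ ε : ℝ, (1 + ε • A).det =
      ((Matrix.det (1 + (Polynomial.X : Polynomial ℝ) • A.map Polynomial.C))).eval ε := by
    intro ε
    rw [← Polynomial.coe_evalRingHom, RingHom.map_det]
    congr 1
    ext i j
    simp [Matrix.one_apply, apply_ite (Polynomial.eval ε)]
    exact mul_comm _ _
  simp only [h2]
  have h3 := Polynomial.hasDerivAt
    (Matrix.det (1 + (Polynomial.X : Polynomial ℝ) • A.map Polynomial.C)) 0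
  rwa [h] at h3

theorem sum_third_first {M : Type*} [AddCommMonoid M] (f : Fin 4 → Fin 4 → Fin 4 → Fin 4 → M) :
    ∑ a, ∑ b, ∑ c, ∑ d, f a b c d = ∑ c, ∑ a, ∑ b, ∑ d, f a b c d :=
  (Finset.sum_congr rfl fun _ _ => Finset.sum_comm).trans Finset.sum_comm

theorem sum_last_first {M : Type*} [AddCommMonoid M] (f : Fin 4 → Fin 4 → Fin 4 → Fin 4 → M) :
    ∑ a, ∑ b, ∑ c, ∑ d, f a b c d = ∑ d, ∑ a, ∑ b, ∑ c, f a b c d :=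
  (Finset.sum_congr rfl fun _ _ => Finset.sum_congr rfl fun _ _ => Finset.sum_comm).trans
    (sum_third_first fun a b d c => f a b c d)

/-- By antisymmetry in the form indices both terms contribute equally, and each is `A` contracted
with the tensor assumed to vanish in `h`. -/
theorem pairing_frame_variation {V : Curv} (hV : IsTwoForm V)
    (h : ∀ c μ, ∑ a, ∑ b, ∑ d, eta a * eta b * eta d * (V a b c d * V a b μ d) = 0)
    (A : Fin 4 → Fin 4 → ℝ) :
    pairing V (fun a b c d => ∑ μ, (A c μ * V a b μ d + A d μ * V a b c μ)) = 0 := by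
  rw [pairing_eq_sum hV]
  have h1 : ∑ a, ∑ b, ∑ c, ∑ d, eta a * eta b * eta c * eta d *
      (V a b c d * ∑ μ, A c μ * V a b μ d) = 0 := by
    rw [sum_third_first]
    refine Finset.sum_eq_zero fun c _ => ?_
    have e : ∀ a b d, eta a * eta b * eta c * eta d * (V a b c d * ∑ μ, A c μ * V a b μ d) =
        ∑ μ, eta c * A c μ * (eta a * eta b * eta d * (V a b c d * V a b μ d)) := by
      intro a b d
      rw [Finset.mul_sum, Finset.mul_sum]
      refine Finset.sum_congr rfl fun μ _ => ?_
      ring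
    simp only [e]
    rw [sum_last_first]
    simp only [← Finset.mul_sum]
    simp [h]
  have h2 : ∑ a, ∑ b, ∑ c, ∑ d, eta a * eta b * eta c * eta d *
      (V a b c d * ∑ μ, A d μ * V a b c μ) = 0 := by
    rw [← h1]
    refine Finset.sum_congr rfl fun a _ => Finset.sum_congr rfl fun b _ => ?_
    rw [Finset.sum_comm]
    refine Finset.sum_congr rfl fun c _ => Finset.sum_congr rfl fun d _ => ?_
    have e : ∑ μ, A c μ * V a b d μ = -∑ μ, A c μ * V a b μ d := by
      rw [← Finset.sum_neg_distrib]
      refine Finset.sum_congr rfl fun μ _ => ?_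
      rw [hV a b d μ]; ring
    rw [e, hV a b d c]; ring
  simp only [Finset.sum_add_distrib, mul_add, h1, h2, add_zero, mul_zero]

theorem pairing_self_eq_zero {V : Curv} (hV : IsTwoForm V)
    (h : ∀ c μ, ∑ a, ∑ b, ∑ d, eta a * eta b * eta d * (V a b c d * V a b μ d) = 0) :
    pairing V V = 0 := by
  -- For `A` the identity the variation is `2 V`: this is the trace of the vanishing tensor.
  have h1 := pairing_frame_variation hV h fun c μ => if μ = c then 1 else 0
  have h2 : (fun a b c d => ∑ μ, ((if μ = c then 1 else 0) * V a b μ d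
      + (if μ = d then 1 else 0) * V a b c μ) : Curv) = (2 : ℝ) • V := by
    ext a b c d
    simp [Finset.sum_add_distrib]; ring
  rw [h2, pairing_smul_right] at h1
  linarith

theorem isTwoForm_frameCurvature (Γ : Connection) (x : Pt) :
    IsTwoForm (frameCurvature cartesian Γ x) := by
  intro a b c d
  rw [frameCurvature_cartesian, frameCurvature_cartesian]
  simp only [curvature, Finset.sum_sub_distrib]
  ring

/-- The coframe equation for a quadratic Lagrangian whose differential at the curvature is
proportional to the curvature, if the energy-momentum tensor vanishes. -/
theorem coframeEquation_of_energyMomentum {ℓ : Curv → ℝ} (B : Curv →ₗ[ℝ] Curv →ₗ[ℝ] ℝ)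
    (hℓ : ∀ R, ℓ R = B R R) {Γ : Connection}
    (hΓ : ContDiff ℝ 1 (frameCurvature cartesian Γ)) {c : ℝ}
    (hB : ∀ x S, B (frameCurvature cartesian Γ x) S + B S (frameCurvature cartesian Γ x) =
      c * pairing (frameCurvature cartesian Γ x) S)
    (hT : ∀ x c μ, ∑ a, ∑ b, ∑ d, eta a * eta b * eta d * (frameCurvature cartesian Γ x a b c d *
      frameCurvature cartesian Γ x a b μ d) = 0) :
    CoframeEquation ℓ cartesian Γ := by
  intro δ hδ hδc
  set V := frameCurvature cartesian Γ with hVdef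
  have hV : ∀ x, IsTwoForm (V x) := isTwoForm_frameCurvature Γ
  have hof : ∀ (ε : ℝ) x, Matrix.of ((cartesian x + ε • δ x : Fin 4 → Fin 4 → ℝ)) =
      1 + ε • Matrix.of (δ x) := by
    intro ε x
    rw [← cartesian_eq_one x]; rfl
  have hdens : ∀ (ε : ℝ) x, density ℓ (fun y => cartesian y + ε • δ y) Γ x =
      (1 + ε • Matrix.of (δ x)).det * B (frameAct (1 + ε • Matrix.of (δ x))⁻¹ (V x))
        (frameAct (1 + ε • Matrix.of (δ x))⁻¹ (V x)) := by
    intro ε x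
    rw [density, hℓ, frameCurvature_eq_frameAct, hof]
  have hdens0 : ∀ x, density ℓ cartesian Γ x = B (V x) (V x) := by
    intro x
    rw [density, hℓ, cartesian_eq_one, Matrix.det_one, one_mul]
  have hδe : ∀ i j, ContDiff ℝ 1 fun x => δ x i j := fun i j =>
    contDiff_pi.mp (contDiff_pi.mp (hδ.of_le (by simp)) i) j
  simp only [hdens, hdens0]
  refine hasDerivAt_integral_of_contDiffAt (f := fun p : ℝ × Pt =>
    (1 + p.1 • Matrix.of (δ p.2)).det * B (frameAct (1 + p.1 • Matrix.of (δ p.2))⁻¹ (V p.2))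
        (frameAct (1 + p.1 • Matrix.of (δ p.2))⁻¹ (V p.2)) - B (V p.2) (V p.2))
    hδc ?_ ?_ ?_ (g := fun _ => 0) ?_ (by simp)
  · intro ε x hx
    have : δ x = 0 := image_eq_zero_of_notMem_tsupport hx
    have e : (1 + ε • Matrix.of (δ x)) = 1 := by rw [this]; ext; simp
    simp only [e, inv_one, frameAct_one, Matrix.det_one]; ring
  · intro x
    have hM : ∀ i j, ContDiff ℝ 1 fun p : ℝ × Pt => (1 + p.1 • Matrix.of (δ p.2)) i j := by
      intro i j
      simp only [Matrix.add_apply, Matrix.smul_apply, Matrix.of_apply, smul_eq_mul]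
      exact contDiff_const.add (contDiff_fst.mul ((hδe i j).comp contDiff_snd))
    have hV1 : ContDiffAt ℝ 1 (fun p : ℝ × Pt => V p.2) (0, x) :=
      (hΓ.comp contDiff_snd).contDiffAt
    have hF := contDiffAt_frameAct (fun i j => contDiffAt_inv hM (x := (0, x)) (by simp) i j) hV1
    exact ((contDiff_det hM).contDiffAt.mul (contDiff_bilin B hF hF)).sub (contDiff_bilin B hV1 hV1)
  · intro x
    simp [frameAct_one]
  · intro x
    have hd := hasDerivAt_det_one_add_smul (Matrix.of (δ x))
    have hF : HasDerivAt (fun ε : ℝ => frameAct (1 + ε • Matrix.of (δ x))⁻¹ (V x))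
        (-(fun a b c d => ∑ μ, (δ x c μ * V x a b μ d + δ x d μ * V x a b c μ))) 0 := by
      rw [hasDerivAt_pi]; intro a
      rw [hasDerivAt_pi]; intro b
      rw [hasDerivAt_pi]; intro c
      rw [hasDerivAt_pi]; intro d
      unfold frameAct
      have hi := fun i j => hasDerivAt_inv_one_add_smul (Matrix.of (δ x)) i j
      have h1 := HasDerivAt.fun_sum (u := Finset.univ) fun (μ : Fin 4) _ =>
        HasDerivAt.fun_sum (u := Finset.univ) fun (ν : Fin 4) _ =>
          ((hi c μ).mul (hi d ν)).mul_const (V x a b μ ν)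
      refine h1.congr_deriv ?_
      simp only [zero_smul, add_zero, inv_one, Matrix.of_apply, Pi.neg_apply]
      simp [Matrix.one_apply, add_mul, Finset.sum_add_distrib]
      exact add_comm _ _
    have h2 := (hd.mul (hasDerivAt_bilin B hF hF)).sub_const (B (V x) (V x))
    refine h2.congr_deriv ?_
    simp only [zero_smul, add_zero, inv_one, frameAct_one, Matrix.det_one, one_mul, hB]
    rw [pairing_neg_right, pairing_frame_variation (hV x) (hT x) (δ x)]
    -- The variation of the determinant multiplies `B(V, V)`, which is half of `c` times `pairing V
    -- V` and hence zero. The integrand thus has zero derivative pointwise.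
    have h3 := hB x (V x)
    rw [pairing_self_eq_zero (hV x) (hT x)] at h3
    have h4 : B (V x) (V x) = 0 := by linarith
    rw [h4]; simp

/-! ### Variations of the connection -/

/-- Half of the first variation of the curvature, before antisymmetrization in the form indices. -/
def covariantVariation (Γ δ : Connection) (x : Pt) (a b μ ν : Fin 4) : ℝ :=
  pd μ (fun y => δ y ν a b) x + ∑ c, (Γ x μ c b * δ x ν a c - δ x ν c b * Γ x μ a c)

/-- The first variation of the frame curvature. -/
def curvatureVariation (Γ δ : Connection) (x : Pt) : Curv := fun a b μ ν =>
  (covariantVariation Γ δ x a b μ ν - covariantVariation Γ δ x a b ν μ) * eta b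

/-- The quadratic part of the frame curvature. -/
def curvatureSquare (δ : Connection) (x : Pt) : Curv := fun a b μ ν =>
  (∑ c, (δ x μ c b * δ x ν a c - δ x ν c b * δ x μ a c)) * eta b

theorem contDiff_connection_apply {Γ : Connection} {n : ℕ∞ω} (hΓ : ContDiff ℝ n Γ)
    (μ a b : Fin 4) : ContDiff ℝ n fun x => Γ x μ a b :=
  contDiff_pi.mp (contDiff_pi.mp (contDiff_pi.mp hΓ μ) a) b

theorem contDiff_pd {f : Pt → ℝ} (hf : ContDiff ℝ ∞ f) (μ : Fin 4) : ContDiff ℝ ∞ (pd μ f) :=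
  (hf.fderiv_right (m := ∞) (by simp)).clm_apply contDiff_const

theorem frameCurvature_add_smul {Γ δ : Connection} (hΓ : ContDiff ℝ ∞ Γ) (hδ : ContDiff ℝ ∞ δ)
    (ε : ℝ) (x : Pt) : frameCurvature cartesian (fun y => Γ y + ε • δ y) x =
      frameCurvature cartesian Γ x + ε • curvatureVariation Γ δ x
        + ε ^ 2 • curvatureSquare δ x := by
  have hpd : ∀ μ ν a b, pd μ (fun y => Γ y ν a b + ε * δ y ν a b) x =
      pd μ (fun y => Γ y ν a b) x + ε * pd μ (fun y => δ y ν a b) x := by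
    intro μ ν a b
    have h1 := (contDiff_connection_apply hΓ ν a b).differentiable (by simp) x
    have h2 := (contDiff_connection_apply hδ ν a b).differentiable (by simp) x
    unfold pd
    rw [fderiv_fun_add h1 (h2.const_mul ε), fderiv_const_mul h2]
    simp
  ext a b μ ν
  simp only [Pi.add_apply, Pi.smul_apply, smul_eq_mul, frameCurvature_cartesian, curvature,
    curvatureVariation, covariantVariation, curvatureSquare, hpd, Fin.sum_univ_four]
  ring

theorem contDiff_frameCurvature {Γ : Connection} (hΓ : ContDiff ℝ ∞ Γ) :
    ContDiff ℝ ∞ (frameCurvature cartesian Γ) := by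
  have h := contDiff_connection_apply hΓ
  refine contDiff_pi.mpr fun a => contDiff_pi.mpr fun b => contDiff_pi.mpr fun μ =>
    contDiff_pi.mpr fun ν => ?_
  simp only [frameCurvature_cartesian, curvature]
  exact (((contDiff_pd (h ν a b) μ).sub (contDiff_pd (h μ a b) ν)).add
    (ContDiff.sum fun c _ => ((h μ c b).mul (h ν a c)).sub ((h ν c b).mul (h μ a c)))).mul
    contDiff_const

theorem contDiff_covariantVariation {Γ δ : Connection} (hΓ : ContDiff ℝ ∞ Γ)
    (hδ : ContDiff ℝ ∞ δ) (a b μ ν : Fin 4) :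
    ContDiff ℝ ∞ fun x => covariantVariation Γ δ x a b μ ν := by
  have h := contDiff_connection_apply hΓ
  have h' := contDiff_connection_apply hδ
  exact (contDiff_pd (h' ν a b) μ).add
    (ContDiff.sum fun c _ => ((h μ c b).mul (h' ν a c)).sub ((h' ν c b).mul (h μ a c)))

theorem contDiff_curvatureVariation {Γ δ : Connection} (hΓ : ContDiff ℝ ∞ Γ)
    (hδ : ContDiff ℝ ∞ δ) : ContDiff ℝ ∞ (curvatureVariation Γ δ) :=
  contDiff_pi.mpr fun a => contDiff_pi.mpr fun b => contDiff_pi.mpr fun μ =>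
    contDiff_pi.mpr fun ν => ((contDiff_covariantVariation hΓ hδ a b μ ν).sub
      (contDiff_covariantVariation hΓ hδ a b ν μ)).mul contDiff_const

theorem contDiff_curvatureSquare {δ : Connection} (hδ : ContDiff ℝ ∞ δ) :
    ContDiff ℝ ∞ (curvatureSquare δ) := by
  have h := contDiff_connection_apply hδ
  exact contDiff_pi.mpr fun a => contDiff_pi.mpr fun b => contDiff_pi.mpr fun μ =>
    contDiff_pi.mpr fun ν => (ContDiff.sum fun c _ =>
      ((h μ c b).mul (h ν a c)).sub ((h ν c b).mul (h μ a c))).mul contDiff_const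

theorem variations_eq_zero {Γ δ : Connection} {x : Pt} (hx : x ∉ tsupport δ) :
    curvatureVariation Γ δ x = 0 ∧ curvatureSquare δ x = 0 := by
  have h0 : δ x = 0 := image_eq_zero_of_notMem_tsupport hx
  have hpd : ∀ μ ν a b, pd μ (fun y => δ y ν a b) x = 0 := by
    intro μ ν a b
    have h1 : (fun y => δ y ν a b) =ᶠ[nhds x] fun _ => 0 := by
      filter_upwards [notMem_tsupport_iff_eventuallyEq.mp hx] with y hy
      rw [hy]; rfl
    unfold pd
    rw [h1.fderiv_eq]; simp
  constructor <;> ext a b μ ν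
  · simp [curvatureVariation, covariantVariation, hpd, h0]
  · simp [curvatureSquare, h0]

/-- Cyclicity of the trace moves the commutator with the connection from the variation `d` onto the
field `v`. -/
theorem sum_commutator_variation (v g d : Fin 4 → Fin 4 → ℝ) :
    ∑ a, ∑ b, eta a * (v a b * ∑ c, (g c b * d a c - d c b * g a c)) =
      ∑ a, ∑ b, d a b * ∑ c, (eta a * v a c * g b c - eta c * v c b * g c a) := by
  simp only [Fin.sum_univ_four]
  ring

/-- The covariant divergence of the curvature, i.e. the Yang–Mills expression. -/
def yangMills (Γ : Connection) (x : Pt) (a b ν : Fin 4) : ℝ :=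
  ∑ μ, eta μ * (eta a * pd μ (fun y => frameCurvature cartesian Γ y a b μ ν) x
    - ∑ c, (eta a * frameCurvature cartesian Γ x a c μ ν * Γ x μ b c
      - eta c * frameCurvature cartesian Γ x c b μ ν * Γ x μ c a))

/-- The pointwise form of integration by parts: the pairing is a total divergence minus `δ`
contracted with the Yang–Mills expression. -/
theorem pairing_curvatureVariation {Γ δ : Connection} (hΓ : ContDiff ℝ ∞ Γ)
    (hδ : ContDiff ℝ ∞ δ) (x : Pt) (hYM : ∀ a b ν, yangMills Γ x a b ν = 0) :
    pairing (frameCurvature cartesian Γ x) (curvatureVariation Γ δ x) =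
      ∑ μ, ∑ ν, ∑ a, ∑ b, eta a * eta μ * eta ν *
        pd μ (fun y => frameCurvature cartesian Γ y a b μ ν * δ y ν a b) x := by
  have hV := isTwoForm_frameCurvature Γ x
  have hpd : ∀ μ ν a b, pd μ (fun y => frameCurvature cartesian Γ y a b μ ν * δ y ν a b) x =
      pd μ (fun y => frameCurvature cartesian Γ y a b μ ν) x * δ x ν a b +
      frameCurvature cartesian Γ x a b μ ν * pd μ (fun y => δ y ν a b) x := by
    intro μ ν a b
    have h1 := (contDiff_connection_apply hδ ν a b).differentiable (by simp) x
    have h2 : DifferentiableAt ℝ (fun y => frameCurvature cartesian Γ y a b μ ν) x :=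
      (contDiff_pi.mp (contDiff_pi.mp (contDiff_pi.mp (contDiff_pi.mp
        (contDiff_frameCurvature hΓ) a) b) μ) ν).differentiable (by simp) x
    unfold pd
    rw [fderiv_fun_mul h2 h1]
    simp
    ring
  rw [pairing_eq_sum hV]
  simp only [hpd]
  unfold yangMills at hYM
  set W : Fin 4 → Fin 4 → Fin 4 → Fin 4 → ℝ := fun μ ν a b =>
    pd μ (fun y => frameCurvature cartesian Γ y a b μ ν) x with hW
  set V := frameCurvature cartesian Γ x
  have hη : ∀ b, eta b * eta b = 1 := by intro b; fin_cases b <;> simp [eta]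
  have reorder : ∀ f : Fin 4 → Fin 4 → Fin 4 → Fin 4 → ℝ,
      ∑ a, ∑ b, ∑ μ, ∑ ν, f a b μ ν = ∑ μ, ∑ ν, ∑ a, ∑ b, f a b μ ν := fun f => by
    rw [sum_third_first]
    refine Finset.sum_congr rfl fun μ _ => ?_
    rw [Finset.sum_congr rfl fun a _ => Finset.sum_comm, Finset.sum_comm]
  -- The two halves of the antisymmetrized variation contribute equally and cancel the `1 / 2` of
  -- `pairing_eq_sum`; the factor `eta b` from lowering the index squares to 1.
  have e1 : ∑ a, ∑ b, ∑ μ, ∑ ν, eta a * eta b * eta μ * eta ν *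
      (V a b μ ν * curvatureVariation Γ δ x a b μ ν) =
      ∑ a, ∑ b, ∑ μ, ∑ ν, eta a * eta μ * eta ν *
        (V a b μ ν * covariantVariation Γ δ x a b μ ν) +
      ∑ a, ∑ b, ∑ μ, ∑ ν, eta a * eta ν * eta μ *
        (V a b ν μ * covariantVariation Γ δ x a b ν μ) := by
    simp only [← Finset.sum_add_distrib]
    refine Finset.sum_congr rfl fun a _ => Finset.sum_congr rfl fun b _ =>
      Finset.sum_congr rfl fun μ _ => Finset.sum_congr rfl fun ν _ => ?_
    simp only [curvatureVariation]
    rw [hV a b ν μ]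
    linear_combination (eta a * eta μ * eta ν * V a b μ ν * (covariantVariation Γ δ x a b μ ν
      - covariantVariation Γ δ x a b ν μ)) * hη b
  have e2 : ∑ a, ∑ b, ∑ μ, ∑ ν, eta a * eta ν * eta μ *
        (V a b ν μ * covariantVariation Γ δ x a b ν μ) =
      ∑ a, ∑ b, ∑ μ, ∑ ν, eta a * eta μ * eta ν *
        (V a b μ ν * covariantVariation Γ δ x a b μ ν) :=
    Finset.sum_congr rfl fun a _ => Finset.sum_congr rfl fun b _ => Finset.sum_comm
  have e3 : ∑ a, ∑ b, ∑ μ, ∑ ν, eta a * eta μ * eta ν *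
        (V a b μ ν * covariantVariation Γ δ x a b μ ν) =
      ∑ μ, ∑ ν, eta μ * eta ν * (∑ a, ∑ b, eta a * (V a b μ ν * pd μ (fun y => δ y ν a b) x) +
        ∑ a, ∑ b, eta a * (V a b μ ν * ∑ c, (Γ x μ c b * δ x ν a c - δ x ν c b * Γ x μ a c)))
      := by
    rw [reorder]
    refine Finset.sum_congr rfl fun μ _ => Finset.sum_congr rfl fun ν _ => ?_
    simp only [← Finset.sum_add_distrib, Finset.mul_sum (s := Finset.univ (α := Fin 4))
      (a := eta μ * eta ν)]
    refine Finset.sum_congr rfl fun a _ => Finset.sum_congr rfl fun b _ => ?_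
    simp only [covariantVariation]; ring
  have e4 : ∑ μ, ∑ ν, ∑ a, ∑ b, eta μ * eta ν * (δ x ν a b * (eta a * W μ ν a b -
      ∑ c, (eta a * V a c μ ν * Γ x μ b c - eta c * V c b μ ν * Γ x μ c a))) = 0 := by
    rw [Finset.sum_comm]
    refine Finset.sum_eq_zero fun ν _ => ?_
    rw [Finset.sum_comm]
    refine Finset.sum_eq_zero fun a _ => ?_
    rw [Finset.sum_comm]
    refine Finset.sum_eq_zero fun b _ => ?_
    have h := congrArg (fun t => eta ν * δ x ν a b * t) (hYM a b ν)
    simp only [mul_zero, Finset.mul_sum (a := eta ν * δ x ν a b)] at h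
    rw [← h]
    refine Finset.sum_congr rfl fun μ _ => ?_
    simp only [hW]; ring
  rw [e1, e2, e3]
  have e5 : ∑ μ, ∑ ν, eta μ * eta ν * (∑ a, ∑ b, eta a * (V a b μ ν * pd μ (fun y => δ y ν a b) x)
      + ∑ a, ∑ b, eta a * (V a b μ ν * ∑ c, (Γ x μ c b * δ x ν a c - δ x ν c b * Γ x μ a c))) +
      ∑ μ, ∑ ν, ∑ a, ∑ b, eta μ * eta ν * (δ x ν a b * (eta a * W μ ν a b -
      ∑ c, (eta a * V a c μ ν * Γ x μ b c - eta c * V c b μ ν * Γ x μ c a))) =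
      ∑ μ, ∑ ν, ∑ a, ∑ b, eta a * eta μ * eta ν *
        (W μ ν a b * δ x ν a b + V a b μ ν * pd μ (fun y => δ y ν a b) x) := by
    rw [← Finset.sum_add_distrib]
    refine Finset.sum_congr rfl fun μ _ => ?_
    rw [← Finset.sum_add_distrib]
    refine Finset.sum_congr rfl fun ν _ => ?_
    rw [sum_commutator_variation (fun a b => V a b μ ν) (fun a b => Γ x μ a b)
      (fun a b => δ x ν a b)]
    simp only [← Finset.sum_add_distrib, Finset.mul_sum (s := Finset.univ (α := Fin 4))
      (a := eta μ * eta ν)]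
    refine Finset.sum_congr rfl fun a _ => Finset.sum_congr rfl fun b _ => ?_
    ring
  rw [← e5, e4]; ring

open MeasureTheory in
theorem integral_sum_pd_eq_zero (k : Fin 4 → Fin 4 → Fin 4 → Fin 4 → ℝ)
    {F : Fin 4 → Fin 4 → Fin 4 → Fin 4 → Pt → ℝ} (hc : ∀ μ ν a b, ContDiff ℝ 1 (F μ ν a b))
    (hs : ∀ μ ν a b, HasCompactSupport (F μ ν a b)) :
    ∫ x, ∑ μ, ∑ ν, ∑ a, ∑ b, k μ ν a b * pd μ (F μ ν a b) x = 0 := by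
  have hi : ∀ μ ν a b, Integrable (fun x => k μ ν a b * pd μ (F μ ν a b) x) := fun μ ν a b =>
    ((((hc μ ν a b).continuous_fderiv (by simp)).clm_apply
      continuous_const).integrable_of_hasCompactSupport ((hs μ ν a b).fderiv_apply ℝ _)).const_mul _
  rw [integral_finsetSum _ fun μ _ => integrable_finsetSum _ fun ν _ =>
    integrable_finsetSum _ fun a _ => integrable_finsetSum _ fun b _ => hi μ ν a b]
  refine Finset.sum_eq_zero fun μ _ => ?_
  rw [integral_finsetSum _ fun ν _ =>
    integrable_finsetSum _ fun a _ => integrable_finsetSum _ fun b _ => hi μ ν a b]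
  refine Finset.sum_eq_zero fun ν _ => ?_
  rw [integral_finsetSum _ fun a _ => integrable_finsetSum _ fun b _ => hi μ ν a b]
  refine Finset.sum_eq_zero fun a _ => ?_
  rw [integral_finsetSum _ fun b _ => hi μ ν a b]
  refine Finset.sum_eq_zero fun b _ => ?_
  rw [integral_const_mul, integral_pd_eq_zero (hc μ ν a b) (hs μ ν a b), mul_zero]

open MeasureTheory in
/-- The connection equation for a quadratic Lagrangian whose differential at the curvature is
proportional to the curvature, if the Yang–Mills equation holds. -/
theorem connectionEquation_of_yangMills {ℓ : Curv → ℝ} (B : Curv →ₗ[ℝ] Curv →ₗ[ℝ] ℝ)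
    (hℓ : ∀ R, ℓ R = B R R) {Γ : Connection} (hΓ : ContDiff ℝ ∞ Γ) {c : ℝ}
    (hB : ∀ x S, B (frameCurvature cartesian Γ x) S + B S (frameCurvature cartesian Γ x) =
      c * pairing (frameCurvature cartesian Γ x) S)
    (hYM : ∀ x a b ν, yangMills Γ x a b ν = 0) : ConnectionEquation ℓ cartesian Γ := by
  intro δ hδ hδc
  set V := frameCurvature cartesian Γ with hVdef
  set D := curvatureVariation Γ δ with hD
  set Q := curvatureSquare δ with hQ
  have hdens : ∀ (ε : ℝ) x, density ℓ cartesian (fun y => Γ y + ε • δ y) x =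
      B (V x + ε • D x + ε ^ 2 • Q x) (V x + ε • D x + ε ^ 2 • Q x) := by
    intro ε x
    rw [density, hℓ, cartesian_eq_one, Matrix.det_one, one_mul, frameCurvature_add_smul hΓ hδ]
  have hdens0 : ∀ x, density ℓ cartesian Γ x = B (V x) (V x) := by
    intro x
    rw [density, hℓ, cartesian_eq_one, Matrix.det_one, one_mul]
  simp only [hdens, hdens0]
  refine hasDerivAt_integral_of_contDiffAt (f := fun p : ℝ × Pt =>
    B (V p.2 + p.1 • D p.2 + p.1 ^ 2 • Q p.2) (V p.2 + p.1 • D p.2 + p.1 ^ 2 • Q p.2)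
      - B (V p.2) (V p.2)) hδc ?_ ?_ ?_ (g := fun x => c * pairing (V x) (D x)) ?_ ?_
  · intro ε x hx
    obtain ⟨h1, h2⟩ := variations_eq_zero (Γ := Γ) hx
    simp [hD, hQ, h1, h2]
  · intro x
    have h1 : ContDiff ℝ 1 fun p : ℝ × Pt => V p.2 :=
      ((contDiff_frameCurvature hΓ).of_le (by simp)).comp contDiff_snd
    have h2 : ContDiff ℝ 1 fun p : ℝ × Pt => D p.2 :=
      ((contDiff_curvatureVariation hΓ hδ).of_le (by simp)).comp contDiff_snd
    have h3 : ContDiff ℝ 1 fun p : ℝ × Pt => Q p.2 :=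
      ((contDiff_curvatureSquare hδ).of_le (by simp)).comp contDiff_snd
    have h4 := ((h1.add (contDiff_fst.smul h2)).add
      ((contDiff_fst.pow 2).smul h3)).contDiffAt (x := ((0 : ℝ), x))
    exact (contDiff_bilin B h4 h4).sub (contDiff_bilin B h1.contDiffAt h1.contDiffAt)
  · intro x
    simp
  · intro x
    have h1 : HasDerivAt (fun ε : ℝ => V x + ε • D x + ε ^ 2 • Q x) (D x) 0 := by
      have := (((hasDerivAt_id (0 : ℝ)).smul_const (D x)).const_add (V x)).add
        (((hasDerivAt_id (0 : ℝ)).pow 2).smul_const (Q x))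
      refine this.congr_deriv ?_
      simp
    refine ((hasDerivAt_bilin B h1 h1).sub_const (B (V x) (V x))).congr_deriv ?_
    simp only [zero_smul, add_zero, ne_eq, OfNat.ofNat_ne_zero, not_false_eq_true, zero_pow, hB]
  · have hc : ∀ μ ν a b, ContDiff ℝ ∞ (fun y => V y a b μ ν * δ y ν a b) := fun μ ν a b =>
      (contDiff_pi.mp (contDiff_pi.mp (contDiff_pi.mp (contDiff_pi.mp
        (contDiff_frameCurvature hΓ) a) b) μ) ν).mul (contDiff_connection_apply hδ ν a b)
    have hs : ∀ μ ν a b, HasCompactSupport (fun y => V y a b μ ν * δ y ν a b) := by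
      intro μ ν a b
      refine HasCompactSupport.intro hδc fun y hy => ?_
      have : δ y = 0 := image_eq_zero_of_notMem_tsupport hy
      rw [this]; simp
    have h := integral_sum_pd_eq_zero (fun μ ν a b => eta a * eta μ * eta ν)
      (F := fun μ ν a b y => V y a b μ ν * δ y ν a b)
      (fun μ ν a b => (hc μ ν a b).of_le (by simp)) hs
    rw [integral_const_mul, integral_congr_ae (Filter.Eventually.of_forall fun x =>
      pairing_curvatureVariation hΓ hδ x (hYM x)), h, mul_zero]

/-! ### The connection of a given contorsion -/

theorem eta_mul_eta (a : Fin 4) : eta a * eta a = 1 := by fin_cases a <;> simp [eta]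

/-- On Minkowski space a metric-compatible connection is determined by its contorsion. -/
theorem connection_eq_of_hasContorsion {Γ : Connection} {K : Pt → Fin 4 → Fin 4 → Fin 4 → ℝ}
    (hm : MetricCompatible Γ) (hK : HasContorsion cartesian Γ K) (x : Pt) (μ a b : Fin 4) :
    Γ x μ a b = eta b * K x μ a b := by
  have h1 : ∀ μ a b, Γ x μ a b * eta b + Γ x μ b a * eta a = 0 := by
    intro μ a b
    have := hm x μ a b
    simpa [nonmetricity, metric] using this
  have h2 : ∀ a μ ν, Γ x μ ν a - Γ x ν μ a = eta a * K x μ ν a - eta a * K x ν μ a := by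
    intro a μ ν
    have := hK.2 x a μ ν
    simpa [torsion, cartesian, pd] using this
  have h3 : ∀ μ a b, K x μ a b + K x μ b a = 0 := fun μ a b => by
    rw [hK.1 x μ a b]; ring
  have d1 : ∀ μ a b, (Γ x μ a b * eta b - K x μ a b) + (Γ x μ b a * eta a - K x μ b a) = 0 :=
    fun μ a b => by linarith [h1 μ a b, h3 μ a b]
  have d2 : ∀ a μ ν, Γ x μ ν a * eta a - K x μ ν a = Γ x ν μ a * eta a - K x ν μ a := by
    intro a μ ν
    linear_combination (eta a) * h2 a μ ν + (K x μ ν a - K x ν μ a) * eta_mul_eta a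
  -- The difference is antisymmetric in its last two indices by `d1` and symmetric under exchange of
  -- the form index with the first external one by `d2`; alternating the two symmetries six times
  -- gives `D = -D`.
  have d3 : Γ x μ a b * eta b - K x μ a b = 0 := by
    linarith [d1 μ a b, d2 a μ b, d1 b μ a, d2 μ b a, d1 a b μ, d2 b a μ]
  linear_combination (eta b) * d3 - Γ x μ a b * eta_mul_eta b

/-! ### Polarized plane waves -/

/-- The components of the real part of `(p + i q) (dx - i α dy) (A + i B)`. -/
def waveForm (α : ℝ) (A B : Fin 4 → Fin 4 → ℝ) (p q : ℝ) (ν a b : Fin 4) : ℝ :=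
  ![0, p * A a b - q * B a b, α * (p * B a b + q * A a b), 0] ν

/-- The connection with contorsion `waveForm`, for amplitudes `P`, `Q`. -/
def waveConnection (α : ℝ) (A B : Fin 4 → Fin 4 → ℝ) (P Q : Pt → ℝ) : Connection :=
  fun x ν a b => eta b * waveForm α A B (P x) (Q x) ν a b

/-- Functions of `t + z` that satisfy the equations of `cos` and `sin` with wave number `κ`. -/
structure IsPhasePair (κ : ℝ) (P Q : Pt → ℝ) : Prop where
  contDiff_left : ContDiff ℝ ∞ P
  contDiff_right : ContDiff ℝ ∞ Q
  pd_left : ∀ μ x, pd μ P x = -(κ * nullForm 1 μ * Q x)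
  pd_right : ∀ μ x, pd μ Q x = κ * nullForm 1 μ * P x

/-- The matrices `A + i B` that commute with and are orthogonal to their complex conjugate. -/
structure IsNullPair (A B : Fin 4 → Fin 4 → ℝ) : Prop where
  antisymm_left : ∀ a b, A a b = -A b a
  antisymm_right : ∀ a b, B a b = -B b a
  comm : ∀ a b, ∑ c, eta c * (A a c * B c b - B a c * A c b) = 0
  norm : ∑ a, ∑ b, eta a * eta b * (A a b ^ 2 + B a b ^ 2) = 0

theorem pd_add {f g : Pt → ℝ} {x : Pt} (hf : DifferentiableAt ℝ f x) (hg : DifferentiableAt ℝ g x)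
    (μ : Fin 4) : pd μ (fun y => f y + g y) x = pd μ f x + pd μ g x := by
  unfold pd; rw [fderiv_fun_add hf hg]; simp

theorem pd_const_mul {f : Pt → ℝ} {x : Pt} (hf : DifferentiableAt ℝ f x) (c : ℝ)
    (μ : Fin 4) : pd μ (fun y => c * f y) x = c * pd μ f x := by
  unfold pd; rw [fderiv_const_mul hf]; simp

theorem waveForm_eq (α : ℝ) (A B : Fin 4 → Fin 4 → ℝ) (p q : ℝ) (ν a b : Fin 4) :
    waveForm α A B p q ν a b = waveForm α A B 1 0 ν a b * p + waveForm α A B 0 1 ν a b * q := by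
  fin_cases ν <;> simp [waveForm] <;> ring

theorem pd_waveForm {κ α : ℝ} {A B : Fin 4 → Fin 4 → ℝ} {P Q : Pt → ℝ} (h : IsPhasePair κ P Q)
    (c : ℝ) (μ ν a b : Fin 4) (x : Pt) :
    pd μ (fun y => c * waveForm α A B (P y) (Q y) ν a b) x =
      c * (κ * nullForm 1 μ * waveForm α A B (-Q x) (P x) ν a b) := by
  have hP := h.contDiff_left.differentiable (by simp) x
  have hQ := h.contDiff_right.differentiable (by simp) x
  simp only [waveForm_eq α A B (P _) (Q _)]
  rw [pd_const_mul (by fun_prop), pd_add (by fun_prop) (by fun_prop), pd_const_mul hP,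
    pd_const_mul hQ, h.pd_left, h.pd_right, waveForm_eq α A B (-Q x) (P x)]
  ring

/-- Multiplication of the phase by `i`. The curvature is built from the rotated pair, so its
derivatives are again covered by `pd_waveForm`. -/
theorem IsPhasePair.rotate {κ : ℝ} {P Q : Pt → ℝ} (h : IsPhasePair κ P Q) :
    IsPhasePair κ (fun x => -Q x) P :=
  ⟨h.contDiff_right.neg, h.contDiff_left,
    fun μ x => by
      have : pd μ (fun x => -Q x) x = -pd μ Q x := by
        unfold pd; rw [fderiv_fun_neg]; simp
      rw [this, h.pd_right],
    fun μ x => by rw [h.pd_left]; ring⟩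

/-- With `ζ = p + i q` and `L = A + i B` the nonzero components are `Re(ζ L)` and `α Im(ζ L)`, whose
commutator is `α |ζ|² [A, B] = 0`. The curvature of a wave connection is therefore linear in the
wave. -/
theorem waveForm_comm {α : ℝ} {A B : Fin 4 → Fin 4 → ℝ} (h : IsNullPair A B) (p q : ℝ)
    (μ ν a b : Fin 4) : ∑ c, eta c * (waveForm α A B p q μ c b * waveForm α A B p q ν a c -
      waveForm α A B p q ν c b * waveForm α A B p q μ a c) = 0 := by
  have hc := h.comm a b
  simp only [Fin.sum_univ_four] at hc ⊢
  fin_cases μ <;> fin_cases ν <;> simp [waveForm]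
  · linear_combination (-α * (p ^ 2 + q ^ 2)) * hc
  · linear_combination (α * (p ^ 2 + q ^ 2)) * hc

theorem frameCurvature_waveConnection {κ α : ℝ} {A B : Fin 4 → Fin 4 → ℝ} {P Q : Pt → ℝ}
    (hP : IsPhasePair κ P Q) (h : IsNullPair A B) (x : Pt) (a b μ ν : Fin 4) :
    frameCurvature cartesian (waveConnection α A B P Q) x a b μ ν =
      κ * (nullForm 1 μ * waveForm α A B (-Q x) (P x) ν a b
        - nullForm 1 ν * waveForm α A B (-Q x) (P x) μ a b) := by
  have hq : ∑ c, (waveConnection α A B P Q x μ c b * waveConnection α A B P Q x ν a c -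
      waveConnection α A B P Q x ν c b * waveConnection α A B P Q x μ a c) = 0 := by
    have := congrArg (fun t => eta b * t) (waveForm_comm (α := α) h (P x) (Q x) μ ν a b)
    simp only [mul_zero, Finset.mul_sum] at this
    rw [← this]
    refine Finset.sum_congr rfl fun c _ => ?_
    simp only [waveConnection]; ring
  rw [frameCurvature_cartesian, curvature, hq]
  have h1 : ∀ μ ν, pd μ (fun y => waveConnection α A B P Q y ν a b) x =
    eta b * (κ * nullForm 1 μ * waveForm α A B (-Q x) (P x) ν a b) := fun μ ν =>
    pd_waveForm hP (eta b) μ ν a b x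
  rw [h1, h1]
  linear_combination (κ * (nullForm 1 μ * waveForm α A B (-Q x) (P x) ν a b
        - nullForm 1 ν * waveForm α A B (-Q x) (P x) μ a b)) * eta_mul_eta b

theorem contDiff_waveConnection {κ α : ℝ} {A B : Fin 4 → Fin 4 → ℝ} {P Q : Pt → ℝ}
    (hP : IsPhasePair κ P Q) : ContDiff ℝ ∞ (waveConnection α A B P Q) := by
  have h1 := hP.contDiff_left
  have h2 := hP.contDiff_right
  refine contDiff_pi.mpr fun μ => contDiff_pi.mpr fun a => contDiff_pi.mpr fun b => ?_
  simp only [waveConnection]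
  have : (fun x => eta b * waveForm α A B (P x) (Q x) μ a b) = fun x => eta b *
    (waveForm α A B 1 0 μ a b * P x + waveForm α A B 0 1 μ a b * Q x) := by
    ext x; rw [waveForm_eq]
  rw [this]
  fun_prop

/-- With `F = l ∧ w`, nullity of `l` and `l · w = 0` leave only `l_c l_μ (w · w)`. The contraction
over `a, b` then produces the norm of `A + i B`, which is zero. -/
theorem waveConnection_energyMomentum {κ α : ℝ} (hα : α ^ 2 = 1) {A B : Fin 4 → Fin 4 → ℝ}
    {P Q : Pt → ℝ} (hP : IsPhasePair κ P Q) (h : IsNullPair A B) (x : Pt) (c μ : Fin 4) :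
    ∑ a, ∑ b, ∑ d, eta a * eta b * eta d *
      (frameCurvature cartesian (waveConnection α A B P Q) x a b c d *
      frameCurvature cartesian (waveConnection α A B P Q) x a b μ d) = 0 := by
  simp only [frameCurvature_waveConnection hP h]
  have e : ∀ a b, ∑ d, eta a * eta b * eta d *
      (κ * (nullForm 1 c * waveForm α A B (-Q x) (P x) d a b
        - nullForm 1 d * waveForm α A B (-Q x) (P x) c a b) *
      (κ * (nullForm 1 μ * waveForm α A B (-Q x) (P x) d a b
        - nullForm 1 d * waveForm α A B (-Q x) (P x) μ a b))) =
      -(κ ^ 2 * nullForm 1 c * nullForm 1 μ * (P x ^ 2 + Q x ^ 2)) *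
        (eta a * eta b * (A a b ^ 2 + B a b ^ 2)) := by
    intro a b
    have e1 : ∀ d, waveForm α A B (-Q x) (P x) d a b = ![0, -(Q x * A a b) - P x * B a b,
      α * (P x * A a b - Q x * B a b), 0] d := by
      intro d; fin_cases d <;> simp [waveForm, -mul_eq_mul_left_iff]; ring
    simp only [Fin.sum_univ_four, e1 0, e1 1, e1 2, e1 3]
    simp [eta, nullForm]
    ring_nf
    simp only [hα]
    ring
  simp only [e, ← Finset.mul_sum, h.norm, mul_zero]

/-- The divergence term vanishes because `l` is null and orthogonal to the wave. In the commutator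
term only `l_ν` times commutators of the wave with its rotated copy survives, a multiple of `[A,
B]`. -/
theorem waveConnection_yangMills {κ α : ℝ} {A B : Fin 4 → Fin 4 → ℝ}
    {P Q : Pt → ℝ} (hP : IsPhasePair κ P Q) (h : IsNullPair A B) (x : Pt) (a b ν : Fin 4) :
    yangMills (waveConnection α A B P Q) x a b ν = 0 := by
  have hpd : ∀ μ, pd μ (fun y => frameCurvature cartesian (waveConnection α A B P Q) y a b μ ν) x =
      κ ^ 2 * nullForm 1 μ * (nullForm 1 μ * waveForm α A B (-P x) (-Q x) ν a b
        - nullForm 1 ν * waveForm α A B (-P x) (-Q x) μ a b) := by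
    intro μ
    simp only [frameCurvature_waveConnection hP h]
    have e : (fun y => κ * (nullForm 1 μ * waveForm α A B (-Q y) (P y) ν a b
        - nullForm 1 ν * waveForm α A B (-Q y) (P y) μ a b)) = fun y =>
        (κ * nullForm 1 μ) * waveForm α A B (-Q y) (P y) ν a b +
        (-(κ * nullForm 1 ν)) * waveForm α A B (-Q y) (P y) μ a b := by
      ext y; ring
    have hd : ∀ c ν, DifferentiableAt ℝ (fun y => c * waveForm α A B (-Q y) (P y) ν a b) x := by
      intro c ν
      have hP' := hP.contDiff_left.differentiable (by simp) x
      have hQ' := hP.contDiff_right.differentiable (by simp) x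
      simp only [waveForm_eq α A B (-Q _) (P _)]
      fun_prop
    rw [e, pd_add (hd _ _) (hd _ _), pd_waveForm hP.rotate, pd_waveForm hP.rotate]
    ring
  have hc := h.comm a b
  simp only [yangMills, hpd]
  simp only [frameCurvature_waveConnection hP h, waveConnection]
  have l0 : nullForm 1 0 = 1 ∧ nullForm 1 1 = 0 ∧ nullForm 1 2 = 0 ∧ nullForm 1 3 = 1 := by
    simp [nullForm]
  have w : ∀ p q a b, waveForm α A B p q 0 a b = 0 ∧
      waveForm α A B p q 1 a b = p * A a b - q * B a b ∧
      waveForm α A B p q 2 a b = α * (p * B a b + q * A a b) ∧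
      waveForm α A B p q 3 a b = 0 := by
    intro p q a b; simp [waveForm]
  have hA := h.antisymm_left
  have hB := h.antisymm_right
  have e : ∀ c, A b c = -A c b ∧ B b c = -B c b ∧ A c a = -A a c ∧ B c a = -B a c :=
    fun c => ⟨hA _ _, hB _ _, hA _ _, hB _ _⟩
  simp only [Fin.sum_univ_four, l0, w, e 0, e 1, e 2, e 3] at hc ⊢
  simp [eta] at hc ⊢
  linear_combination ((1 + α ^ 2) * κ * nullForm 1 ν * ![1, -1, -1, -1] a * (P x ^ 2 + Q x ^ 2)) * hc

/-- A quadratic Lagrangian whose differential at the curvature is proportional to the curvature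
has its equations of motion satisfied by a polarized wave connection. -/
theorem equationsOfMotion_waveConnection {κ α : ℝ} (hα : α ^ 2 = 1) {A B : Fin 4 → Fin 4 → ℝ}
    {P Q : Pt → ℝ} (hP : IsPhasePair κ P Q) (h : IsNullPair A B) {ℓ : Curv → ℝ}
    (F : Curv →ₗ[ℝ] Curv →ₗ[ℝ] ℝ) (hℓ : ∀ R, ℓ R = F R R) {c : ℝ}
    (hF : ∀ x S, F (frameCurvature cartesian (waveConnection α A B P Q) x) S +
      F S (frameCurvature cartesian (waveConnection α A B P Q) x) =
      c * pairing (frameCurvature cartesian (waveConnection α A B P Q) x) S) :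
    EquationsOfMotion ℓ cartesian (waveConnection α A B P Q) :=
  have hΓ := contDiff_waveConnection (α := α) (A := A) (B := B) hP
  ⟨coframeEquation_of_energyMomentum F hℓ ((contDiff_frameCurvature hΓ).of_le (by simp)) hF
      (waveConnection_energyMomentum hα hP h),
    connectionEquation_of_yangMills F hℓ hΓ hF (waveConnection_yangMills hP h)⟩

/-! ### Polarized complex bivectors -/

theorem IsPolarized.components {L : Fin 4 → Fin 4 → ℂ} {α' : ℝ} (hL : IsPolarized L α') :
    L 2 3 = α' * Complex.I * L 0 1 ∧ L 3 1 = α' * Complex.I * L 0 2 ∧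
      L 1 2 = α' * Complex.I * L 0 3 := by
  obtain ⟨h1, h2⟩ := hL
  have e1 := h2 0 1
  have e2 := h2 0 2
  have e3 := h2 0 3
  rw [star2_apply] at e1 e2 e3
  simp only [Matrix.cons_val_zero, Matrix.cons_val_one, Matrix.cons_val] at e1 e2 e3
  rw [h1 3 2] at e1
  rw [h1 1 3] at e2
  rw [h1 2 1] at e3
  simp only [Complex.real_smul] at e1 e2 e3
  push_cast at e1 e2 e3
  refine ⟨?_, ?_, ?_⟩
  · rw [← e1]; ring
  · rw [← e2]; ring
  · rw [← e3]; ring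

/-- The conjugate of `L` has the opposite duality, and bivectors of opposite duality commute and are
orthogonal. In real terms, `[L, L̄] = -2i [A, B]` and `L · L̄` is the sum of the squares of `A` and
`B` taken with the metric signs. -/
theorem IsPolarized.isNullPair {L : Fin 4 → Fin 4 → ℂ} {α' : ℝ} (hα' : α' ^ 2 = 1)
    (hL : IsPolarized L α') :
    IsNullPair (fun a b => (L a b).re) (fun a b => (L a b).im) := by
  have hre : ∀ a b, (L a b).re = -(L b a).re := fun a b => by rw [hL.1 a b]; simp
  have him : ∀ a b, (L a b).im = -(L b a).im := fun a b => by rw [hL.1 a b]; simp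
  obtain ⟨h1, h2, h3⟩ := hL.components
  have hd : ∀ a, (L a a).re = 0 ∧ (L a a).im = 0 := fun a =>
    ⟨by linarith [hre a a], by linarith [him a a]⟩
  have r23 : (L 2 3).re = -α' * (L 0 1).im := by rw [h1]; simp
  have i23 : (L 2 3).im = α' * (L 0 1).re := by rw [h1]; simp
  have r13 : (L 1 3).re = α' * (L 0 2).im := by rw [hre, h2]; simp
  have i13 : (L 1 3).im = -α' * (L 0 2).re := by rw [him, h2]; simp
  have r12 : (L 1 2).re = -α' * (L 0 3).im := by rw [h3]; simp
  have i12 : (L 1 2).im = α' * (L 0 3).re := by rw [h3]; simp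
  have key := And.intro (hre 1 0) (And.intro (hre 2 0) (And.intro (hre 3 0) (And.intro (hre 2 1)
    (And.intro (hre 3 1) (hre 3 2)))))
  have key' := And.intro (him 1 0) (And.intro (him 2 0) (And.intro (him 3 0) (And.intro (him 2 1)
    (And.intro (him 3 1) (him 3 2)))))
  refine ⟨hre, him, fun a b => ?_, ?_⟩
  · fin_cases a <;> fin_cases b <;>
      simp [Fin.sum_univ_four, hd, key, key', r23, i23, r13, i13, r12, i12, eta] <;> ring_nf <;>
      simp [hα']
  · simp [Fin.sum_univ_four, hd, key, key', r23, i23, r13, i13, r12, i12, eta, mul_pow, hα']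
    ring

/-! ### The plane wave -/

/-- The real part of the amplitude of the plane wave. -/
def phaseCos (C κ : ℝ) (x : Pt) : ℝ := C * Real.cos (κ * (x 0 + x 3))

/-- The imaginary part of the amplitude of the plane wave. -/
def phaseSin (C κ : ℝ) (x : Pt) : ℝ := C * Real.sin (κ * (x 0 + x 3))

theorem isPhasePair (C κ : ℝ) : IsPhasePair κ (phaseCos C κ) (phaseSin C κ) := by
  have hl : ∀ x : Pt, HasFDerivAt (fun y : Pt => κ * (y 0 + y 3))
      (κ • (ContinuousLinearMap.proj (R := ℝ) (φ := fun _ : Fin 4 => ℝ) 0 +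
        ContinuousLinearMap.proj 3)) x := fun x =>
    (((ContinuousLinearMap.proj (R := ℝ) (φ := fun _ : Fin 4 => ℝ) 0).hasFDerivAt).add
      (ContinuousLinearMap.proj (R := ℝ) (φ := fun _ : Fin 4 => ℝ) 3).hasFDerivAt).const_mul κ
  refine ⟨?_, ?_, fun μ x => ?_, fun μ x => ?_⟩
  · unfold phaseCos; fun_prop
  · unfold phaseSin; fun_prop
  · unfold pd
    have h := ((hl x).cos.const_mul C).fderiv
    have e : phaseCos C κ = fun y => C * Real.cos (κ * (y 0 + y 3)) := rfl
    rw [e, h]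
    fin_cases μ <;> simp [phaseSin, nullForm] <;> ring
  · unfold pd
    have h := ((hl x).sin.const_mul C).fderiv
    have e : phaseSin C κ = fun y => C * Real.sin (κ * (y 0 + y 3)) := rfl
    rw [e, h]
    fin_cases μ <;> simp [phaseCos, nullForm] <;> ring

theorem planeWave_eq (C k s α : ℝ) (x : Pt) (μ : Fin 4) : planeWave C k s α x μ =
    (phaseCos C (s * k) x + phaseSin C (s * k) x * Complex.I) *
      ![0, 1, -(Complex.I * α), 0] μ := by
  have h : (s * Complex.I * (k * (x 0 + x 3)) : ℂ) =
      ((s * k * (x 0 + x 3) : ℝ) : ℂ) * Complex.I := by push_cast; ring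
  unfold planeWave
  rw [h, Complex.exp_mul_I, ← Complex.ofReal_cos, ← Complex.ofReal_sin]
  simp only [phaseCos, phaseSin]
  push_cast
  ring

theorem reContorsion_planeWave (C k s α : ℝ) (L : Fin 4 → Fin 4 → ℂ) (x : Pt) (μ a b : Fin 4) :
    reContorsion (planeWave C k s α) L x μ a b =
      waveForm α (fun a b => (L a b).re) (fun a b => (L a b).im) (phaseCos C (s * k) x)
        (phaseSin C (s * k) x) μ a b := by
  rw [reContorsion, planeWave_eq]
  fin_cases μ <;> simp [waveForm]; ring

/-- The connection with a contorsion built from a polarized plane wave. -/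
theorem eq_waveConnection {C k s α : ℝ} {L : Fin 4 → Fin 4 → ℂ} {Γ : Connection}
    (hm : MetricCompatible Γ)
    (hK : HasContorsion cartesian Γ (reContorsion (planeWave C k s α) L)) :
    Γ = waveConnection α (fun a b => (L a b).re) (fun a b => (L a b).im) (phaseCos C (s * k))
        (phaseSin C (s * k)) := by
  ext x μ a b
  rw [connection_eq_of_hasContorsion hm hK, reContorsion_planeWave, waveConnection]

theorem pd_planeWave (C k s α : ℝ) (x : Pt) (μ ν : Fin 4) :
    pd μ (fun y => planeWave C k s α y ν) x =
      s * Complex.I * k * nullForm 1 μ * planeWave C k s α x ν := by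
  have hl : HasFDerivAt (fun y : Pt => (s * Complex.I * (k * (y 0 + y 3)) : ℂ))
      ((s * Complex.I : ℂ) • ((k : ℂ) • (Complex.ofRealCLM.comp
        (ContinuousLinearMap.proj (R := ℝ) (φ := fun _ : Fin 4 => ℝ) 0) + Complex.ofRealCLM.comp
        (ContinuousLinearMap.proj (R := ℝ) (φ := fun _ : Fin 4 => ℝ) 3)))) x :=
    (((Complex.ofRealCLM.comp
        (ContinuousLinearMap.proj (R := ℝ) (φ := fun _ : Fin 4 => ℝ) 0)).hasFDerivAt.add
      (Complex.ofRealCLM.comp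
        (ContinuousLinearMap.proj (R := ℝ) (φ := fun _ : Fin 4 => ℝ) 3)).hasFDerivAt).const_mul
        (k : ℂ)).const_mul (s * Complex.I : ℂ)
  have h := ((hl.cexp.const_mul (C : ℂ)).mul_const
    ((![0, 1, -(Complex.I * α), 0] : Fin 4 → ℂ) ν)).fderiv
  unfold pd planeWave
  rw [h]
  generalize (![0, 1, -(Complex.I * α), 0] : Fin 4 → ℂ) ν = m
  fin_cases μ <;> simp [nullForm] <;> ring

/-! ### The Yang–Mills-like Lagrangian -/

/-- The exchange of the two external indices. -/
def transposeL : Curv →ₗ[ℝ] Curv where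
  toFun S := fun a b => S b a
  map_add' _ _ := rfl
  map_smul' _ _ := rfl

/-- The bilinear form of the Yang–Mills-like Lagrangian. -/
def lagKVBilin (ρ : ℝ) : Curv →ₗ[ℝ] Curv →ₗ[ℝ] ℝ :=
  (-(1 / (2 * ρ))) • pairingL.compl₂ transposeL

theorem lagKVBilin_apply (ρ : ℝ) (R S : Curv) :
    lagKVBilin ρ R S = -(1 / (2 * ρ)) * pairing R (fun a b => S b a) := rfl

/-- The curvature takes values in the Lorentz algebra, so transposing its external indices is a
change of sign, and both slots of the bilinear form give the same multiple of the pairing. -/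
theorem equationsOfMotion_lagKV {κ α : ℝ} (hα : α ^ 2 = 1) {A B : Fin 4 → Fin 4 → ℝ}
    {P Q : Pt → ℝ} (hP : IsPhasePair κ P Q) (h : IsNullPair A B) (ρ : ℝ) :
    EquationsOfMotion (lagKV ρ) cartesian (waveConnection α A B P Q) := by
  refine equationsOfMotion_waveConnection hα hP h (lagKVBilin ρ) (fun R => rfl)
    (c := 2 * (1 / (2 * ρ))) fun x S => ?_
  set V := frameCurvature cartesian (waveConnection α A B P Q) x with hV
  have hw : ∀ p q ν a b, waveForm α A B p q ν a b = -waveForm α A B p q ν b a := by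
    intro p q ν a b
    have h1 := h.antisymm_left a b
    have h2 := h.antisymm_right a b
    fin_cases ν <;> simp [waveForm, h1, h2] <;> ring
  have hanti : ∀ a b, V a b = -V b a := by
    intro a b
    ext μ ν
    simp only [hV, frameCurvature_waveConnection hP h, Pi.neg_apply]
    rw [hw _ _ ν a b, hw _ _ μ a b]; ring
  have hT : (fun a b => V b a) = -V := by ext a b : 2; exact hanti b a
  rw [lagKVBilin_apply, lagKVBilin_apply, pairing_transpose_of_antisymm hanti, hT,
    pairing_neg_right, pairing_comm S V]
  ring

/-! ### The strong-sector Lagrangian -/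

theorem strongL_nullWeyl {τ : ℝ} (hτ : τ ^ 2 = 1) (p q : ℝ) (w : Fin 6 → ℝ) (z v : Fin 5 → ℝ) :
    strongL w z v (nullWeyl τ p q) = w 0 • nullWeyl τ p q := by
  have h0 : ∀ J, J ≠ weyl → partL J (nullWeyl τ p q) = 0 := fun J => partL_nullWeyl hτ p q
  have h1 : partL (.inl 0) (nullWeyl τ p q) = nullWeyl τ p q :=
    (partL_apply _ _).trans (part_weyl_nullWeyl hτ p q)
  have hW5 : W5L (nullWeyl τ p q) = 0 := h0 (.inl 4) (by decide)
  have hZ2 : Z2L (nullWeyl τ p q) = 0 := h0 (.inr 1) (by decide)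
  have hZ3 : Z3L (nullWeyl τ p q) = 0 := h0 (.inr 2) (by decide)
  have hZ4 : Z4L (nullWeyl τ p q) = 0 := h0 (.inr 3) (by decide)
  have hZ5 : Z5L (nullWeyl τ p q) = 0 := h0 (.inr 4) (by decide)
  have hw : ∑ I, w I • partL (.inl I) (nullWeyl τ p q) = w 0 • nullWeyl τ p q := by
    rw [Finset.sum_eq_single 0, h1]
    · intro I _ hI
      rw [h0 _ fun h => hI (Sum.inl.inj h), smul_zero]
    · simp
  have hz : ∑ I, z I • partL (.inr I) (nullWeyl τ p q) = 0 :=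
    Finset.sum_eq_zero fun I _ => by rw [h0 _ (by simp [weyl]), smul_zero]
  simp only [strongL, LinearMap.add_apply, LinearMap.smul_apply, LinearMap.sum_apply,
    LinearMap.comp_apply, hw, hz, hW5, hZ2, hZ3, hZ4, hZ5, map_zero, smul_zero, add_zero]

/-- The same eigenvalue for the adjoint of `strongL`. Both versions enter the differential of the
Lagrangian, and the mixing terms do not make `strongL` evidently symmetric. -/
theorem pairing_nullWeyl_strongL {τ : ℝ} (hτ : τ ^ 2 = 1) (p q : ℝ) (w : Fin 6 → ℝ)
    (z v : Fin 5 → ℝ) (S : Curv) :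
    pairing (nullWeyl τ p q) (strongL w z v S) = w 0 * pairing (nullWeyl τ p q) S := by
  have hA : ∀ T, pairing (nullWeyl τ p q) (mixAL T) = 0 := fun T =>
    pairing_nullWeyl_mixA hτ p q T
  have hB : pairing (nullWeyl τ p q) (mixBL (Z2L S)) = 0 :=
    pairing_nullWeyl_mixB τ p q (Zpart_symm 1 S) (Z2_mem_twoForms S)
  have h0 : ∀ J, J ≠ weyl → pairing (nullWeyl τ p q) (partL J S) = 0 := fun J hJ => by
    rw [partL_apply]; exact pairing_nullWeyl_part hτ p q hJ S
  have h1 : pairing (nullWeyl τ p q) (partL (.inl 0) S) = pairing (nullWeyl τ p q) S := by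
    rw [partL_apply]; exact pairing_nullWeyl_W1 hτ p q S
  have hw : ∑ I, w I * pairing (nullWeyl τ p q) (partL (.inl I) S) =
      w 0 * pairing (nullWeyl τ p q) S := by
    rw [Finset.sum_eq_single 0, h1]
    · intro I _ hI
      rw [h0 _ fun h => hI (Sum.inl.inj h), mul_zero]
    · simp
  have hz : ∑ I, z I * pairing (nullWeyl τ p q) (partL (.inr I) S) = 0 :=
    Finset.sum_eq_zero fun I _ => by rw [h0 _ (by simp [weyl]), mul_zero]
  simp only [strongL, LinearMap.add_apply, LinearMap.smul_apply, LinearMap.sum_apply,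
    LinearMap.comp_apply, pairing_add_right, pairing_smul_right, pairing_sum_right, hw, hz, hA, hB,
    mul_zero, add_zero]

/-- The bilinear form of the strong-sector Lagrangian. -/
def lagStrongBilin (ρ : ℝ) (w : Fin 6 → ℝ) (z v : Fin 5 → ℝ) : Curv →ₗ[ℝ] Curv →ₗ[ℝ] ℝ :=
  (-(1 / (2 * ρ))) • pairingL.compl₂ (strongL w z v)

theorem lagStrongBilin_apply (ρ : ℝ) (w : Fin 6 → ℝ) (z v : Fin 5 → ℝ) (R S : Curv) :
    lagStrongBilin ρ w z v R S = -(1 / (2 * ρ)) * pairing R (strongL w z v S) := rfl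

theorem equationsOfMotion_lagStrong {κ α : ℝ} (hα : α ^ 2 = 1) {A B : Fin 4 → Fin 4 → ℝ}
    {P Q : Pt → ℝ} (hP : IsPhasePair κ P Q) (h : IsNullPair A B)
    (hN : ∀ x, ∃ p q, frameCurvature cartesian (waveConnection α A B P Q) x = nullWeyl 1 p q)
    (ρ : ℝ) (w : Fin 6 → ℝ) (z v : Fin 5 → ℝ) :
    EquationsOfMotion (lagStrong ρ w z v) cartesian (waveConnection α A B P Q) := by
  refine equationsOfMotion_waveConnection hα hP h (lagStrongBilin ρ w z v)
    (fun R => by rw [lagStrong_eq, lagStrongBilin_apply])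
    (c := -(2 * (1 / (2 * ρ)) * w 0)) fun x S => ?_
  obtain ⟨p, q, hx⟩ := hN x
  rw [hx, lagStrongBilin_apply, lagStrongBilin_apply, strongL_nullWeyl (by norm_num),
    pairing_nullWeyl_strongL (by norm_num), pairing_smul_right, pairing_comm S]
  ring

/-! ### The wave contorsion `2 Re (b ∂b)` -/

/-- The complex bivector `c i (dt + dz) ∧ (dx - i α dy)`. -/
def waveBivector (c α : ℝ) (a b : Fin 4) : ℂ := c * (α * nullY 1 a b + Complex.I * nullX 1 a b)

/-- For `τ = 1`, `⋆nullX = nullY` and `⋆nullY = -nullX`, so the polarization `α` of the wave is also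
the duality of the bivector. -/
theorem isPolarized_waveBivector (c : ℝ) {α : ℝ} (hα : α ^ 2 = 1) :
    IsPolarized (waveBivector c α) α := by
  have hα' : (α : ℂ) ^ 2 = 1 := by exact_mod_cast hα
  refine ⟨fun a b => ?_, fun a b => ?_⟩
  · rw [waveBivector, waveBivector, nullX_antisymm, nullY_antisymm]; push_cast; ring
  · rw [star2_apply]
    simp only [waveBivector, nullX_eq, nullY_eq]
    fin_cases a <;> fin_cases b <;> simp <;> ring_nf <;> simp [hα']

theorem planeWave_mul (C k s α : ℝ) (x : Pt) (μ ν : Fin 4) :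
    planeWave C k s α x μ * planeWave C k s α x ν =
      C * planeWave C (2 * k) s α x μ * ![0, 1, -(Complex.I * α), 0] ν := by
  have h : Complex.exp (s * Complex.I * ((2 * k : ℝ) * (x 0 + x 3))) =
      Complex.exp (s * Complex.I * (k * (x 0 + x 3))) *
      Complex.exp (s * Complex.I * (k * (x 0 + x 3))) := by
    rw [← Complex.exp_add]; congr 1; push_cast; ring
  simp only [planeWave, h]
  ring

/-- The derivative of `b` brings down `i s k (dt + dz)`, and the product of two equal exponentials
doubles the wave number. One factor `C` stays in the wave; the other, with `s k`, goes into the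
bivector. -/
theorem waveContorsion_eq (C k s α : ℝ) :
    waveContorsion (planeWave C k s α) =
      reContorsion (planeWave C (2 * k) s α) (waveBivector (C * s * k) α) := by
  ext x μ ν σ
  rw [waveContorsion, reContorsion, pd_planeWave, pd_planeWave]
  have e : (2 : ℝ) * (planeWave C k s α x μ * (1 / 2 *
      (s * Complex.I * k * nullForm 1 ν * planeWave C k s α x σ -
        s * Complex.I * k * nullForm 1 σ * planeWave C k s α x ν))).re =
      (s * Complex.I * k * (nullForm 1 ν * (planeWave C k s α x μ * planeWave C k s α x σ) -
        nullForm 1 σ * (planeWave C k s α x μ * planeWave C k s α x ν))).re := by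
    rw [← Complex.re_ofReal_mul]
    congr 1; push_cast; ring
  rw [e, planeWave_mul, planeWave_mul]
  congr 1
  have hm : ∀ ν : Fin 4, (![0, 1, -(Complex.I * α), 0] : Fin 4 → ℂ) ν =
      ((![0, 1, 0, 0] : Fin 4 → ℝ) ν : ℂ) - Complex.I * α * ((![0, 0, 1, 0] : Fin 4 → ℝ) ν : ℂ) := by
    intro ν; fin_cases ν <;> simp
  rw [hm, hm, waveBivector, nullX, nullY, wedge11, wedge11]
  push_cast
  ring_nf
  rw [Complex.I_sq]
  ring

/-- The bivector and the wave have the same polarization vector `m`, so the curvature is `-κ c Re((P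
+ i Q) (l ∧ m) ⊗ (l ∧ m))`. Expanding with `l ∧ m = nullX - iα nullY` gives the two coefficients. -/
theorem frameCurvature_waveBivector {κ α c : ℝ} (hα : α ^ 2 = 1) {P Q : Pt → ℝ}
    (hP : IsPhasePair κ P Q)
    (h : IsNullPair (fun a b => (waveBivector c α a b).re) fun a b => (waveBivector c α a b).im)
    (x : Pt) :
    frameCurvature cartesian (waveConnection α (fun a b => (waveBivector c α a b).re)
      (fun a b => (waveBivector c α a b).im) P Q) x =
      nullWeyl 1 (-(κ * c * P x)) (-(κ * c * α * Q x)) := by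
  ext a b μ ν
  rw [frameCurvature_waveConnection hP h]
  have hre : (waveBivector c α a b).re = c * α * nullY 1 a b := by simp [waveBivector]; ring
  have him : (waveBivector c α a b).im = c * nullX 1 a b := by simp [waveBivector]
  have hw : ∀ p q (ν : Fin 4), waveForm α (fun a b => (waveBivector c α a b).re)
      (fun a b => (waveBivector c α a b).im) p q ν a b =
      (p * (c * α * nullY 1 a b) - q * (c * nullX 1 a b)) * (![0, 1, 0, 0] : Fin 4 → ℝ) ν +
      α * (p * (c * nullX 1 a b) + q * (c * α * nullY 1 a b)) * (![0, 0, 1, 0] : Fin 4 → ℝ) ν := by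
    intro p q ν
    fin_cases ν <;> simp [waveForm, hre, him]
  rw [hw, hw]
  simp only [nullWeyl]
  have hX : nullX 1 μ ν = nullForm 1 μ * (![0, 1, 0, 0] : Fin 4 → ℝ) ν
    - nullForm 1 ν * (![0, 1, 0, 0] : Fin 4 → ℝ) μ := by simp only [nullX, wedge11]
  have hY : nullY 1 μ ν = nullForm 1 μ * (![0, 0, 1, 0] : Fin 4 → ℝ) ν
    - nullForm 1 ν * (![0, 0, 1, 0] : Fin 4 → ℝ) μ := by simp only [nullY, wedge11]
  rw [hX, hY]
  linear_combination (κ * P x * c * nullY 1 a b * (nullForm 1 μ * (![0, 0, 1, 0] : Fin 4 → ℝ) ν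
    - nullForm 1 ν * (![0, 0, 1, 0] : Fin 4 → ℝ) μ)) * hα

end MAG

end

/-! ### The theorem on polarized wave contorsions. -/

theorem theorem5 (C k s α : ℝ) (hk : 0 < k) (hs : s = 1 ∨ s = -1) (hα : α = 1 ∨ α = -1) :
    (∀ (α' : ℝ) (_ : α' = 1 ∨ α' = -1) (L : Fin 4 → Fin 4 → ℂ) (_ : IsPolarized L α')
        (Γ : Connection) (_ : MetricCompatible Γ)
        (_ : HasContorsion cartesian Γ (reContorsion (planeWave C k s α) L))
        (ρ : ℝ) (_ : ρ ≠ 0),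
        EquationsOfMotion (lagKV ρ) cartesian Γ) ∧
    (∀ (Γ : Connection) (_ : MetricCompatible Γ)
        (_ : HasContorsion cartesian Γ (waveContorsion (planeWave C k s α))),
        (∃ (α' : ℝ) (L : Fin 4 → Fin 4 → ℂ), (α' = 1 ∨ α' = -1) ∧ IsPolarized L α' ∧
          HasContorsion cartesian Γ (reContorsion (planeWave C (2 * k) s α) L)) ∧
        IsPseudoInstanton cartesian Γ weyl ∧
        IsSimplePseudoInstanton cartesian Γ weyl ∧
        ∀ (ρ : ℝ) (_ : ρ ≠ 0) (w : Fin 6 → ℝ) (z v : Fin 5 → ℝ),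
          EquationsOfMotion (lagStrong ρ w z v) cartesian Γ) := by
  have hα2 : α ^ 2 = 1 := by rcases hα with rfl | rfl <;> norm_num
  refine ⟨fun α' hα' L hL Γ hm hK ρ _ => ?_, fun Γ hm hK => ?_⟩
  · rw [eq_waveConnection hm hK]
    exact equationsOfMotion_lagKV hα2 (isPhasePair C _)
      (hL.isNullPair (by rcases hα' with rfl | rfl <;> norm_num)) ρ
  · rw [waveContorsion_eq] at hK
    have hL := isPolarized_waveBivector (C * s * k) hα2
    have hN := hL.isNullPair hα2
    have hP := isPhasePair C (s * (2 * k))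
    have hΓ := eq_waveConnection hm hK
    have hcurv : ∀ x, ∃ p q, frameCurvature cartesian Γ x = nullWeyl 1 p q := fun x => by
      rw [hΓ]; exact ⟨_, _, frameCurvature_waveBivector hα2 hP hN x⟩
    have hinst : IsPseudoInstanton cartesian Γ weyl := by
      refine ⟨hm, fun x => ?_⟩
      obtain ⟨p, q, hx⟩ := hcurv x
      rw [hx]
      exact ⟨(part_weyl_nullWeyl (by norm_num) p q).symm, fun J hJ =>
        part_nullWeyl (by norm_num) p q hJ⟩
    refine ⟨⟨α, _, hα, hL, hK⟩, hinst, ⟨hinst, isSimplePart_weyl⟩, fun ρ _ w z v => ?_⟩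
    rw [hΓ] at hcurv ⊢
    exact equationsOfMotion_lagStrong hα2 hP hN hcurv ρ w z v
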